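/- Let $T,M$ be smooth manifolds with $p=\dim T>2$, $n=\dim M>2$, and let $(t^\alpha,x^i,x^i_\alpha)$ be the induced coordinates on $J^1(T,M)$ over a chart of $T$ and a chart of $M$. Let $h_{\alpha\beta}(t)$ be a smooth semi-Riemannian metric on $T$ with Christoffel symbols $H^\gamma_{\alpha\beta}$, let $g_{ij}(t,x,x_\gamma)$ be a smooth symmetric nondegenerate d-tensor on $J^1(T,M)$, put $M^{(i)}_{(\alpha)\beta}=-H^\mu_{\alpha\beta}x^i_\mu$, and let $N^{(i)}_{(\alpha)j}$ be an arbitrary smooth spatial nonlinear connection. Let $$X_\alpha=\frac{\delta}{\delta t^\alpha}=\frac{\partial}{\partial t^\alpha}-M^{(j)}_{(\beta)\alpha}\frac{\partial}{\partial x^j_\beta},\qquad X_i=\frac{\delta}{\delta x^i}=\frac{\partial}{\partial x^i}-N^{(j)}_{(\beta)i}\frac{\partial}{\partial x^j_\beta},\qquad X^{(\alpha)}_{(i)}=\frac{\partial}{\partial x^i_\alpha}$$ be the adapted frame $(X_A)$, with dual coframe $dt^\alpha,\ dx^i,\ \delta x^i_\alpha=dx^i_\alpha+M^{(i)}_{(\alpha)\beta}dt^\beta+N^{(i)}_{(\alpha)j}dx^j$,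 and let $$G=h_{\alpha\beta}\,dt^\alpha\otimes dt^\beta+g_{ij}\,dx^i\otimes dx^j+h^{\alpha\beta}g_{ij}\,\delta x^i_\alpha\otimes\delta x^j_\beta .$$ The Cartan canonical connection $C\Gamma=(H^\gamma_{\alpha\beta},G^k_{j\gamma},L^i_{jk},C^{i(\gamma)}_{j(k)})$ has $$G^k_{j\gamma}=\tfrac12 g^{ki}\tfrac{\delta g_{ij}}{\delta t^\gamma},\quad L^i_{jk}=\tfrac12 g^{im}\Big(\tfrac{\delta g_{mj}}{\delta x^k}+\tfrac{\delta g_{mk}}{\delta x^j}-\tfrac{\delta g_{jk}}{\delta x^m}\Big),\quad C^{i(\gamma)}_{j(k)}=\tfrac12 g^{im}\Big(\tfrac{\partial g_{mj}}{\partial x^k_\gamma}+\tfrac{\partial g_{mk}}{\partial x^j_\gamma}-\tfrac{\partial g_{jk}}{\partial x^m_\gamma}\Big);$$ its covariant derivatives along $\delta/\delta t^\gamma$, $\delta/\delta x^k$, $\partial/\partial x^k_\gamma$ are written $_{/\gamma}$, $_{|k}$, $|^{(\gamma)}_{(k)}$, and they act on temporal indices by $H,0,0$ and on spatial indices by $G,L,C$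 respectively (so the vertical part of the connection has coefficients $\delta^\beta_\alpha G^k_{i\gamma}-\delta^k_iH^\beta_{\alpha\gamma}$, $\delta^\beta_\alpha L^k_{ij}$, $\delta^\beta_\alpha C^{k(\gamma)}_{i(j)}$). Its curvature components are given by $\mathbf R(X_C,X_B)X_A=R^D_{ABC}X_D$; in particular $P^{l\,(\gamma)}_{ij(k)}$ and $S^{l(\beta)(\gamma)}_{i(j)(k)}$ are the components of $\mathbf R\big(\tfrac{\partial}{\partial x^k_\gamma},\tfrac{\delta}{\delta x^j}\big)\tfrac{\delta}{\delta x^i}$ and $\mathbf R\big(\tfrac{\partial}{\partial x^k_\gamma},\tfrac{\partial}{\partial x^j_\beta}\big)\tfrac{\delta}{\delta x^i}$ along $\tfrac{\delta}{\delta x^l}$. The Ricci d-tensor is $R_{AB}=R^D_{ABD}$, with blocks $H_{\alpha\beta}$, $R_{ij}$, $S^{(\alpha)(\beta)}_{(i)(j)}$, $R_{i\beta}$, $P^{(\alpha)}_{(i)\beta}$, $P^{(\alpha)}_{(i)j}$, $P^{\ (\beta)}_{i(j)}$. Put $H=h^{\alpha\beta}H_{\alpha\beta}$, $R=g^{ij}R_{ij}$,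 $S=h_{\alpha\beta}g^{ij}S^{(\alpha)(\beta)}_{(i)(j)}$, $Sc=G^{AB}R_{AB}$, and raise the first index by $W^B_A=G^{BD}W_{DA}$; in particular $R^m_\beta=g^{mi}R_{i\beta}$, $P^{(m)}_{(\mu)\beta}=g^{mi}h_{\mu\alpha}P^{(\alpha)}_{(i)\beta}$, $P^{(m)}_{(\mu)j}=g^{mi}h_{\mu\alpha}P^{(\alpha)}_{(i)j}$, $P^{m(\alpha)}_{\ \ (i)}=g^{mk}P^{\ (\alpha)}_{k(i)}$. Let $\mathcal K\neq0$ be a constant and let the stress-energy d-tensor $\mathcal T$ satisfy the Einstein equations $R_{AB}-\frac{Sc}{2}G_{AB}=\mathcal K\,\mathcal T_{AB}$. Define $$\tilde{\mathcal T}_{\alpha\beta}=\mathcal T_{\alpha\beta}+\tfrac{R+S}{2\mathcal K}h_{\alpha\beta},\quad \tilde{\mathcal T}_{ij}=\mathcal T_{ij}+\tfrac{H+S}{2\mathcal K}g_{ij},\quad \tilde{\mathcal T}^{(\alpha)(\beta)}_{(i)(j)}=\mathcal T^{(\alpha)(\beta)}_{(i)(j)}+\tfrac{H+R}{2\mathcal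 K}h^{\alpha\beta}g_{ij},$$ with traces $\tilde{\mathcal T}_T=h^{\alpha\beta}\tilde{\mathcal T}_{\alpha\beta}$, $\tilde{\mathcal T}_M=g^{ij}\tilde{\mathcal T}_{ij}$, $\tilde{\mathcal T}_v=h_{\alpha\beta}g^{ij}\tilde{\mathcal T}^{(\alpha)(\beta)}_{(i)(j)}$ and mixed components $\tilde{\mathcal T}^\mu_\beta=h^{\mu\alpha}\tilde{\mathcal T}_{\alpha\beta}$, $\tilde{\mathcal T}^m_j=g^{mi}\tilde{\mathcal T}_{ij}$, $\tilde{\mathcal T}^{(m)(\alpha)}_{(\mu)(i)}=g^{mk}h_{\mu\beta}\tilde{\mathcal T}^{(\beta)(\alpha)}_{(k)(i)}$. (a) If $\mathcal T$ satisfies the conservation laws $\mathcal T^B_{A|B}=0$ for all adapted indices $A$ (total covariant divergence, summed over temporal, spatial and vertical $B$), then $$\begin{aligned} \mathcal K\Big[\tilde{\mathcal T}^\mu_{\beta/\mu}-\tfrac1{2-n}\tilde{\mathcal T}_{M/\beta}-\tfrac1{2-pn}\tilde{\mathcal T}_{v/\beta}\Big]&=-R^m_{\beta|m}-P^{(m)}_{(\mu)\beta}|^{(\mu)}_{(m)},\\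 \mathcal K\Big[-\tfrac1{2-p}\tilde{\mathcal T}_{T|j}+\tilde{\mathcal T}^m_{j|m}-\tfrac1{2-pn}\tilde{\mathcal T}_{v|j}\Big]&=-P^{(m)}_{(\mu)j}|^{(\mu)}_{(m)},\\ \mathcal K\Big[-\tfrac1{2-p}\tilde{\mathcal T}_T|^{(\alpha)}_{(i)}-\tfrac1{2-n}\tilde{\mathcal T}_M|^{(\alpha)}_{(i)}+\tilde{\mathcal T}^{(m)(\alpha)}_{(\mu)(i)}|^{(\mu)}_{(m)}\Big]&=-P^{m(\alpha)}_{\ \ (i)|m}. \end{aligned}$$ (b) If the curvature d-tensors $P^{l\,(\mu)}_{qi(m)}$ and $S^{l(\alpha)(\mu)}_{q(i)(m)}$ vanish identically, then $$\tilde{\mathcal T}^\mu_{\beta/\mu}=0,\qquad \tilde{\mathcal T}^m_{i|m}=0,\qquad \tilde{\mathcal T}^{(m)(\alpha)}_{(\mu)(i)}|^{(\mu)}_{(m)}=0 .$$ -/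

import Mathlib

open scoped ContDiff

/-- Induced coordinates `(t^α, x^i, x^i_α)` on the first jet space `J¹(T, M)`, `dim T = p`,
`dim M = n`: for `z : Jet p n`, `z.1 α = t^α`, `z.2.1 i = x^i`, `z.2.2 i α = x^i_α`. -/
abbrev Jet (p n : ℕ) : Type :=
  (Fin p → ℝ) × (Fin n → ℝ) × (Fin n → Fin p → ℝ)

/-- Indices `A ∈ {α, i, (i)(α)}` of the adapted frame `δ/δt^α, δ/δx^i, ∂/∂x^i_α`. -/
abbrev Idx (p n : ℕ) : Type := Fin p ⊕ Fin n ⊕ (Fin n × Fin p)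

namespace Idx

/-- The index of `δ/δt^α`. -/
@[reducible] def t {p n : ℕ} (α : Fin p) : Idx p n := Sum.inl α

/-- The index of `δ/δx^i`. -/
@[reducible] def x {p n : ℕ} (i : Fin n) : Idx p n := Sum.inr (Sum.inl i)

/-- The index of `∂/∂x^i_α`. -/
@[reducible] def v {p n : ℕ} (i : Fin n) (α : Fin p) : Idx p n := Sum.inr (Sum.inr (i, α))

end Idx

/-- A generalized metrical multi-time Lagrange space together with a spatial nonlinear connection,
in a chart `U` of `T` and a chart `V` of `M`: a semi-Riemannian metric `h_{αβ}(t)` on `T`, a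
symmetric nondegenerate `g_{ij}(t, x, x_α)` on the jet space (so that the vertical fundamental
metrical d-tensor is `h^{αβ} g_{ij}`), and an arbitrary spatial nonlinear connection
`N^{(i)}_{(α)j}`, written `N z i α j`; all of them smooth. -/
structure GMLSpace (p n : ℕ) where
  U : Set (Fin p → ℝ)
  V : Set (Fin n → ℝ)
  isOpen_U : IsOpen U
  isOpen_V : IsOpen V
  h : (Fin p → ℝ) → Matrix (Fin p) (Fin p) ℝ
  g : Jet p n → Matrix (Fin n) (Fin n) ℝ
  N : Jet p n → Fin n → Fin p → Fin n → ℝ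
  h_smooth : ∀ α β, ContDiffOn ℝ ∞ (fun s => h s α β) U
  h_symm : ∀ s ∈ U, (h s).IsSymm
  h_nondeg : ∀ s ∈ U, (h s).det ≠ 0
  g_smooth : ∀ i j, ContDiffOn ℝ ∞ (fun z => g z i j) {z | z.1 ∈ U ∧ z.2.1 ∈ V}
  g_symm : ∀ z : Jet p n, z.1 ∈ U → z.2.1 ∈ V → (g z).IsSymm
  g_nondeg : ∀ z : Jet p n, z.1 ∈ U → z.2.1 ∈ V → (g z).det ≠ 0
  N_smooth : ∀ i α j, ContDiffOn ℝ ∞ (fun z => N z i α j) {z | z.1 ∈ U ∧ z.2.1 ∈ V}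

namespace GMLSpace

variable {p n : ℕ} (Q : GMLSpace p n)

/-- The part of the jet space lying over the two charts. -/
def E : Set (Jet p n) := {z | z.1 ∈ Q.U ∧ z.2.1 ∈ Q.V}

/-- `∂h_{αβ}/∂t^γ`. -/
noncomputable def dh (s : Fin p → ℝ) (α β γ : Fin p) : ℝ :=
  fderiv ℝ (fun r => Q.h r α β) s (Pi.single γ 1)

/-- The Christoffel symbols `H^γ_{αβ}` of the temporal metric. -/
noncomputable def H (s : Fin p → ℝ) (γ α β : Fin p) : ℝ :=
  (1 / 2) * ∑ μ, (Q.h s)⁻¹ γ μ * (Q.dh s μ α β + Q.dh s μ β α - Q.dh s α β μ)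

/-- The canonical temporal nonlinear connection `M^{(i)}_{(α)β} = - H^μ_{αβ} x^i_μ`. -/
noncomputable def M (z : Jet p n) (i : Fin n) (α β : Fin p) : ℝ :=
  - ∑ μ, Q.H z.1 μ α β * z.2.2 i μ

/-- The adapted frame `δ/δt^α = ∂/∂t^α - M^{(j)}_{(β)α} ∂/∂x^j_β`,
`δ/δx^i = ∂/∂x^i - N^{(j)}_{(β)i} ∂/∂x^j_β`, `∂/∂x^i_α`. -/
noncomputable def frame (A : Idx p n) (z : Jet p n) : Jet p n :=
  match A with
  | Sum.inl α => (Pi.single α 1, 0, fun j β => - Q.M z j β α)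
  | Sum.inr (Sum.inl i) => (0, Pi.single i 1, fun j β => - Q.N z j β i)
  | Sum.inr (Sum.inr (i, α)) => (0, 0, Pi.single i (Pi.single α 1))

/-- The dual coframe `dt^α`, `dx^i`, `δx^i_α = dx^i_α + M^{(i)}_{(α)β} dt^β + N^{(i)}_{(α)j} dx^j`,
evaluated at `z` on the tangent vector `w`. -/
noncomputable def coframe (A : Idx p n) (z w : Jet p n) : ℝ :=
  match A with
  | Sum.inl α => w.1 α
  | Sum.inr (Sum.inl i) => w.2.1 i
  | Sum.inr (Sum.inr (i, α)) =>
      w.2.2 i α + ∑ β, Q.M z i α β * w.1 β + ∑ j, Q.N z i α j * w.2.1 j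

/-- The derivative `X_A f` of a function along the adapted frame. -/
noncomputable def D (A : Idx p n) (f : Jet p n → ℝ) (z : Jet p n) : ℝ :=
  fderiv ℝ f z (Q.frame A z)

/-- `X_A g_{ij}`. -/
noncomputable def dg (z : Jet p n) (A : Idx p n) (i j : Fin n) : ℝ :=
  Q.D A (fun w => Q.g w i j) z

/-- `G^k_{jγ} = (g^{ki}/2) δg_{ij}/δt^γ`. -/
noncomputable def Gc (z : Jet p n) (k j : Fin n) (γ : Fin p) : ℝ :=
  (1 / 2) * ∑ i, (Q.g z)⁻¹ k i * Q.dg z (Idx.t γ) i j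

/-- `L^i_{jk} = (g^{im}/2) (δg_{mj}/δx^k + δg_{mk}/δx^j - δg_{jk}/δx^m)`. -/
noncomputable def L (z : Jet p n) (i j k : Fin n) : ℝ :=
  (1 / 2) * ∑ m, (Q.g z)⁻¹ i m *
    (Q.dg z (Idx.x k) m j + Q.dg z (Idx.x j) m k - Q.dg z (Idx.x m) j k)

/-- `C^{i(γ)}_{j(k)} = (g^{im}/2) (∂g_{mj}/∂x^k_γ + ∂g_{mk}/∂x^j_γ - ∂g_{jk}/∂x^m_γ)`. -/
noncomputable def C (z : Jet p n) (i j k : Fin n) (γ : Fin p) : ℝ :=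
  (1 / 2) * ∑ m, (Q.g z)⁻¹ i m *
    (Q.dg z (Idx.v k γ) m j + Q.dg z (Idx.v j γ) m k - Q.dg z (Idx.v m γ) j k)

/-- The Cartan canonical connection in the adapted frame: `∇_{X_B} X_A = conn z F A B • X_F`
(sum over `F`). It is `h`-normal: it preserves the three distributions, acts on the temporal
one by `(H, 0, 0)`, on the spatial one by `(G, L, C)`, and on the vertical one by
`δ^β_α G^k_{iγ} - δ^k_i H^β_{αγ}`, `δ^β_α L^k_{ij}`, `δ^β_α C^{k(γ)}_{i(j)}`. -/
noncomputable def conn (z : Jet p n) (F A B : Idx p n) : ℝ :=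
  match F, A, B with
  | Sum.inl γ, Sum.inl α, Sum.inl β => Q.H z.1 γ α β
  | Sum.inr (Sum.inl k), Sum.inr (Sum.inl i), Sum.inl γ => Q.Gc z k i γ
  | Sum.inr (Sum.inl k), Sum.inr (Sum.inl i), Sum.inr (Sum.inl j) => Q.L z k i j
  | Sum.inr (Sum.inl k), Sum.inr (Sum.inl i), Sum.inr (Sum.inr (j, γ)) => Q.C z k i j γ
  | Sum.inr (Sum.inr (k, α)), Sum.inr (Sum.inr (i, β)), Sum.inl γ =>
      (if β = α then Q.Gc z k i γ else 0) - (if k = i then Q.H z.1 β α γ else 0)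
  | Sum.inr (Sum.inr (k, α)), Sum.inr (Sum.inr (i, β)), Sum.inr (Sum.inl j) =>
      if β = α then Q.L z k i j else 0
  | Sum.inr (Sum.inr (k, α)), Sum.inr (Sum.inr (i, β)), Sum.inr (Sum.inr (j, γ)) =>
      if β = α then Q.C z k i j γ else 0
  | _, _, _ => 0

/-- The curvature components `R^F_{ABC}` of the Cartan canonical connection,
`R(X_C, X_B) X_A = R^F_{ABC} X_F` with `R(X, Y) = [∇_X, ∇_Y] - ∇_{[X, Y]}`. -/
noncomputable def curv (z : Jet p n) (F A B C : Idx p n) : ℝ :=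
  Q.D C (fun w => Q.conn w F A B) z - Q.D B (fun w => Q.conn w F A C) z
    + ∑ K, (Q.conn z K A B * Q.conn z F K C - Q.conn z K A C * Q.conn z F K B)
    - ∑ K, Q.coframe K z (VectorField.lieBracket ℝ (Q.frame C) (Q.frame B) z) * Q.conn z F A K

/-- The curvature d-tensor `P^{l (γ)}_{ij(k)}` (`P^l_{ij}` along `vh_M`). -/
noncomputable def curvP (z : Jet p n) (l i j k : Fin n) (γ : Fin p) : ℝ :=
  Q.curv z (Idx.x l) (Idx.x i) (Idx.x j) (Idx.v k γ)

/-- The curvature d-tensor `S^{l(β)(γ)}_{i(j)(k)}`. -/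
noncomputable def curvS (z : Jet p n) (l i j k : Fin n) (β γ : Fin p) : ℝ :=
  Q.curv z (Idx.x l) (Idx.x i) (Idx.v j β) (Idx.v k γ)

/-- The Ricci d-tensor `R_{AB} = R^F_{ABF}`. Its blocks are `H_{αβ}`, `R_{iβ}`, `R_{ij}`,
`P^{(α)}_{(i)β}`, `P^{(α)}_{(i)j}`, `P^{(β)}_{i(j)}`, `S^{(α)(β)}_{(i)(j)}`. -/
noncomputable def Ric (z : Jet p n) (A B : Idx p n) : ℝ :=
  ∑ F, Q.curv z F A B F

/-- The adapted metric
`G = h_{αβ} dt^α ⊗ dt^β + g_{ij} dx^i ⊗ dx^j + h^{αβ} g_{ij} δx^i_α ⊗ δx^j_β`. -/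
noncomputable def metric (z : Jet p n) (A B : Idx p n) : ℝ :=
  match A, B with
  | Sum.inl α, Sum.inl β => Q.h z.1 α β
  | Sum.inr (Sum.inl i), Sum.inr (Sum.inl j) => Q.g z i j
  | Sum.inr (Sum.inr (i, α)), Sum.inr (Sum.inr (j, β)) => (Q.h z.1)⁻¹ α β * Q.g z i j
  | _, _ => 0

/-- The inverse `G^{AB}` of the adapted metric. -/
noncomputable def invMetric (z : Jet p n) (A B : Idx p n) : ℝ :=
  match A, B with
  | Sum.inl α, Sum.inl β => (Q.h z.1)⁻¹ α β
  | Sum.inr (Sum.inl i), Sum.inr (Sum.inl j) => (Q.g z)⁻¹ i j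
  | Sum.inr (Sum.inr (i, α)), Sum.inr (Sum.inr (j, β)) => Q.h z.1 α β * (Q.g z)⁻¹ i j
  | _, _ => 0

/-- The partial trace `h^{αβ} W_{αβ}` of a covariant d-tensor of order two. -/
noncomputable def trT (W : Jet p n → Idx p n → Idx p n → ℝ) (z : Jet p n) : ℝ :=
  ∑ α, ∑ β, (Q.h z.1)⁻¹ α β * W z (Idx.t α) (Idx.t β)

/-- The partial trace `g^{ij} W_{ij}`. -/
noncomputable def trM (W : Jet p n → Idx p n → Idx p n → ℝ) (z : Jet p n) : ℝ :=
  ∑ i, ∑ j, (Q.g z)⁻¹ i j * W z (Idx.x i) (Idx.x j)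

/-- The partial trace `h_{αβ} g^{ij} W^{(α)(β)}_{(i)(j)}`. -/
noncomputable def trV (W : Jet p n → Idx p n → Idx p n → ℝ) (z : Jet p n) : ℝ :=
  ∑ i, ∑ α, ∑ j, ∑ β, Q.h z.1 α β * (Q.g z)⁻¹ i j * W z (Idx.v i α) (Idx.v j β)

/-- The scalar curvature `Sc = G^{AB} R_{AB}`. -/
noncomputable def Sc (z : Jet p n) : ℝ :=
  ∑ A, ∑ B, Q.invMetric z A B * Q.Ric z A B

/-- The Einstein equations `Ric - (Sc/2) G = 𝒦 𝒯`, in all adapted components. -/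
def Einstein (𝒦 : ℝ) (𝒯 : Jet p n → Idx p n → Idx p n → ℝ) : Prop :=
  ∀ z ∈ Q.E, ∀ A B, Q.Ric z A B - Q.Sc z / 2 * Q.metric z A B = 𝒦 * 𝒯 z A B

/-- Raising the first index: `W^B_A = G^{BF} W_{FA}`, written `raise W z B A`. -/
noncomputable def raise (W : Jet p n → Idx p n → Idx p n → ℝ) (z : Jet p n) (B A : Idx p n) : ℝ :=
  ∑ F, Q.invMetric z B F * W z F A

/-- The covariant derivative `∇_{X_C} W^B_A` of a mixed d-tensor `W^B_A = W z B A`. -/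
noncomputable def cov (W : Jet p n → Idx p n → Idx p n → ℝ) (z : Jet p n) (C B A : Idx p n) : ℝ :=
  Q.D C (fun w => W w B A) z
    + ∑ F, Q.conn z B F C * W z F A - ∑ F, Q.conn z F A C * W z B F

/-- The partial divergence `W^μ_{A/μ}` of the mixed tensor obtained from `W_{BA}`. -/
noncomputable def divT (W : Jet p n → Idx p n → Idx p n → ℝ) (z : Jet p n) (A : Idx p n) : ℝ :=
  ∑ μ, Q.cov (Q.raise W) z (Idx.t μ) (Idx.t μ) A

/-- The partial divergence `W^m_{A|m}` of the mixed tensor obtained from `W_{BA}`. -/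
noncomputable def divM (W : Jet p n → Idx p n → Idx p n → ℝ) (z : Jet p n) (A : Idx p n) : ℝ :=
  ∑ m, Q.cov (Q.raise W) z (Idx.x m) (Idx.x m) A

/-- The partial divergence `W^{(m)}_{(μ)A}|^{(μ)}_{(m)}` of the mixed tensor obtained from
`W_{BA}`. -/
noncomputable def divV (W : Jet p n → Idx p n → Idx p n → ℝ) (z : Jet p n) (A : Idx p n) : ℝ :=
  ∑ m, ∑ μ, Q.cov (Q.raise W) z (Idx.v m μ) (Idx.v m μ) A

/-- The conservation laws `𝒯^B_{A|B} = 0` for all adapted indices `A`. -/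
def Conserved (𝒯 : Jet p n → Idx p n → Idx p n → ℝ) : Prop :=
  ∀ z ∈ Q.E, ∀ A, Q.divT 𝒯 z A + Q.divM 𝒯 z A + Q.divV 𝒯 z A = 0

/-- The new stress-energy d-tensor: with `H`, `R`, `S` the partial traces of the Ricci d-tensor,
`𝒯_{αβ} + (R+S)/(2𝒦) h_{αβ}`, `𝒯_{ij} + (H+S)/(2𝒦) g_{ij}`,
`𝒯^{(α)(β)}_{(i)(j)} + (H+R)/(2𝒦) h^{αβ} g_{ij}`. The mixed blocks, which play no role, are kept. -/
noncomputable def newT (𝒦 : ℝ) (𝒯 : Jet p n → Idx p n → Idx p n → ℝ)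
    (z : Jet p n) (A B : Idx p n) : ℝ :=
  match A, B with
  | Sum.inl α, Sum.inl β =>
      𝒯 z (Idx.t α) (Idx.t β) + (Q.trM Q.Ric z + Q.trV Q.Ric z) / (2 * 𝒦) * Q.h z.1 α β
  | Sum.inr (Sum.inl i), Sum.inr (Sum.inl j) =>
      𝒯 z (Idx.x i) (Idx.x j) + (Q.trT Q.Ric z + Q.trV Q.Ric z) / (2 * 𝒦) * Q.g z i j
  | Sum.inr (Sum.inr (i, α)), Sum.inr (Sum.inr (j, β)) =>
      𝒯 z (Idx.v i α) (Idx.v j β)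
        + (Q.trT Q.Ric z + Q.trM Q.Ric z) / (2 * 𝒦) * ((Q.h z.1)⁻¹ α β * Q.g z i j)
  | A, B => 𝒯 z A B

end GMLSpace

/-! ### Smooth functions, the adapted frame and its structure functions. -/

namespace GMLSpace

variable {p n : ℕ} (Q : GMLSpace p n)

/-! Since `Sc` = H + R + S, the corrections in `newT` remove from each diagonal block of the
Einstein equations the traces of the other two blocks. So 𝒦 times the new tensor is Ric - (H/2)h,
Ric - (R/2)g, Ric - (S/2)h⁻¹g on the three blocks (`Einstein.newT_shifted`). The connection
preserves the three distributions, and raising an index turns the metric into the identity.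
Subtracting a scalar multiple of the metric on each block therefore changes a mixed covariant
derivative only by the derivative of that scalar (`cov_shifted`).

For (a), tracing the blocks gives 2𝒦 times the new traces as (2-p)H, (2-n)R, (2-pn)S, so the terms
with 1/(2-p), 1/(2-n), 1/(2-pn) are halves of the derivatives of H, R, S. With d`Sc` = dH + dR + dS,
each law is a linear rearrangement of one conservation law. The temporal divergence is absent from
the last two because R_{αj} and R_α^{(β)}_{(j)} vanish (`Ric_t_x`, `Ric_t_v`).

For (b), the first two laws are contracted second Bianchi identities (`divT_Ric`, `divM_Ric`). The
frame is anholonomic, but all its brackets are vertical (`bracket_t`, `bracket_x`), so the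
additional Bianchi terms only involve curvature with a vertical leg. That curvature is zero for the
temporal connection and is P for the spatial one. The third law is trivial: S = 0 annihilates the
vertical Ricci block. The Bianchi identity (`curvOf_bianchi`) is proved for arbitrary connection
matrices, using the Jacobi identity `bracket_jacobi`, and contracted for metric connections in
`IsMetric.contracted_bianchi`. -/

/-- Smooth functions on the part of the jet space lying over the two charts. -/
def Smooth (f : Jet p n → ℝ) : Prop := ContDiffOn ℝ ∞ f Q.E

theorem isOpen_E : IsOpen Q.E :=
  (Q.isOpen_U.preimage continuous_fst).inter
    (Q.isOpen_V.preimage (continuous_fst.comp continuous_snd))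

variable {Q}

theorem Smooth.differentiableAt {f : Jet p n → ℝ} (hf : Q.Smooth f) {z : Jet p n} (hz : z ∈ Q.E) :
    DifferentiableAt ℝ f z :=
  (hf.differentiableOn (by simp)).differentiableAt (Q.isOpen_E.mem_nhds hz)

theorem smooth_const (c : ℝ) : Q.Smooth fun _ => c := contDiffOn_const

theorem Smooth.add {f f' : Jet p n → ℝ} (hf : Q.Smooth f) (hf' : Q.Smooth f') :
    Q.Smooth fun z => f z + f' z := ContDiffOn.add hf hf'

theorem Smooth.sub {f f' : Jet p n → ℝ} (hf : Q.Smooth f) (hf' : Q.Smooth f') :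
    Q.Smooth fun z => f z - f' z := ContDiffOn.sub hf hf'

theorem Smooth.mul {f f' : Jet p n → ℝ} (hf : Q.Smooth f) (hf' : Q.Smooth f') :
    Q.Smooth fun z => f z * f' z := ContDiffOn.mul hf hf'

theorem Smooth.neg {f : Jet p n → ℝ} (hf : Q.Smooth f) : Q.Smooth fun z => - f z :=
  ContDiffOn.neg hf

theorem Smooth.const_mul {f : Jet p n → ℝ} (c : ℝ) (hf : Q.Smooth f) :
    Q.Smooth fun z => c * f z := (smooth_const c).mul hf

theorem Smooth.sum {ι : Type*} {s : Finset ι} {f : ι → Jet p n → ℝ}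
    (hf : ∀ i ∈ s, Q.Smooth (f i)) : Q.Smooth fun z => ∑ i ∈ s, f i z :=
  ContDiffOn.sum hf

theorem Smooth.congr {f f' : Jet p n → ℝ} (hf : Q.Smooth f) (h : ∀ z ∈ Q.E, f' z = f z) :
    Q.Smooth f' := ContDiffOn.congr hf h

/-- The entries of the inverse of a smooth matrix function are smooth. -/
theorem smooth_inv {ι : Type*} [Fintype ι] [DecidableEq ι] {W : Jet p n → Matrix ι ι ℝ}
    (hW : ∀ i j, Q.Smooth fun z => W z i j) (hdet : ∀ z ∈ Q.E, (W z).det ≠ 0) (i j : ι) :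
    Q.Smooth fun z => (W z)⁻¹ i j := by
  have key : ∀ A : Jet p n → Matrix ι ι ℝ, (∀ i j, Q.Smooth fun z => A z i j) →
      Q.Smooth fun z => (A z).det := by
    intro A hA
    simp only [Matrix.det_apply, Units.smul_def, zsmul_eq_mul]
    exact Smooth.sum fun σ _ => Smooth.const_mul _ (contDiffOn_prod fun k _ => hA _ _)
  have hadj : Q.Smooth fun z => (W z).adjugate i j := by
    simp only [Matrix.adjugate_apply]
    refine key _ fun a b => ?_
    by_cases hab : a = j
    · subst hab
      simpa using smooth_const _
    · simpa [Matrix.updateRow_ne hab] using hW a b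
  have hd : Q.Smooth fun z => ((W z).det)⁻¹ := ContDiffOn.inv (key W hW) hdet
  refine (hd.mul hadj).congr fun z _ => ?_
  simp [Matrix.inv_def]

theorem mapsTo_fst_E : Set.MapsTo Prod.fst Q.E Q.U := fun _ hz => hz.1

theorem smooth_comp_fst {f : (Fin p → ℝ) → ℝ} (hf : ContDiffOn ℝ ∞ f Q.U) :
    Q.Smooth fun z => f z.1 := hf.comp contDiffOn_fst mapsTo_fst_E

theorem smooth_g (i j : Fin n) : Q.Smooth fun z => Q.g z i j := Q.g_smooth i j

theorem smooth_h (α β : Fin p) : Q.Smooth fun z => Q.h z.1 α β := smooth_comp_fst (Q.h_smooth α β)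

theorem smooth_N (i : Fin n) (α : Fin p) (j : Fin n) : Q.Smooth fun z => Q.N z i α j :=
  Q.N_smooth i α j

theorem smooth_gInv (i j : Fin n) : Q.Smooth fun z => (Q.g z)⁻¹ i j :=
  smooth_inv (fun i j => smooth_g i j) (fun z hz => Q.g_nondeg z hz.1 hz.2) i j

theorem smooth_hInv (α β : Fin p) : Q.Smooth fun z => (Q.h z.1)⁻¹ α β :=
  smooth_inv (fun i j => smooth_h i j) (fun z hz => Q.h_nondeg z.1 hz.1) α β

theorem smooth_dh (α β γ : Fin p) : Q.Smooth fun z => Q.dh z.1 α β γ :=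
  smooth_comp_fst (((Q.h_smooth α β).fderiv_of_isOpen (m := ∞) Q.isOpen_U (by simp)).clm_apply
    contDiffOn_const)

theorem smooth_H (γ α β : Fin p) : Q.Smooth fun z => Q.H z.1 γ α β :=
  Smooth.const_mul _ (Smooth.sum fun μ _ => (smooth_hInv γ μ).mul
    (((smooth_dh _ _ _).add (smooth_dh _ _ _)).sub (smooth_dh _ _ _)))

theorem smooth_M (i : Fin n) (α β : Fin p) : Q.Smooth fun z => Q.M z i α β := by
  refine Smooth.neg (Smooth.sum fun μ _ => (smooth_H μ α β).mul ?_)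
  exact ContDiff.contDiffOn (by fun_prop)

theorem contDiffOn_frame (A : Idx p n) : ContDiffOn ℝ ∞ (Q.frame A) Q.E := by
  rcases A with α | i | ⟨i, α⟩
  · refine contDiffOn_const.prodMk (contDiffOn_const.prodMk ?_)
    exact contDiffOn_pi.2 fun j => contDiffOn_pi.2 fun β => (smooth_M j β α).neg
  · refine contDiffOn_const.prodMk (contDiffOn_const.prodMk ?_)
    exact contDiffOn_pi.2 fun j => contDiffOn_pi.2 fun β => (smooth_N j β i).neg
  · exact contDiffOn_const

theorem differentiableAt_frame (A : Idx p n) {z : Jet p n} (hz : z ∈ Q.E) :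
    DifferentiableAt ℝ (Q.frame A) z :=
  ((contDiffOn_frame A).differentiableOn (by simp)).differentiableAt (Q.isOpen_E.mem_nhds hz)

theorem Smooth.D {f : Jet p n → ℝ} (hf : Q.Smooth f) (A : Idx p n) : Q.Smooth (Q.D A f) :=
  (ContDiffOn.fderiv_of_isOpen hf (m := ∞) Q.isOpen_E (by simp)).clm_apply (contDiffOn_frame A)

section Derivation

variable {f f' : Jet p n → ℝ} {z : Jet p n} (A : Idx p n)

theorem D_congr (hz : z ∈ Q.E) (h : ∀ w ∈ Q.E, f w = f' w) : Q.D A f z = Q.D A f' z := by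
  have : f =ᶠ[nhds z] f' := Filter.eventuallyEq_of_mem (Q.isOpen_E.mem_nhds hz) h
  rw [D, D, this.fderiv_eq]

theorem D_const (c : ℝ) : Q.D A (fun _ => c) z = 0 := by simp [D]

theorem D_add (hz : z ∈ Q.E) (hf : Q.Smooth f) (hf' : Q.Smooth f') :
    Q.D A (fun w => f w + f' w) z = Q.D A f z + Q.D A f' z := by
  rw [D, fderiv_fun_add (hf.differentiableAt hz) (hf'.differentiableAt hz)]; rfl

theorem D_sub (hz : z ∈ Q.E) (hf : Q.Smooth f) (hf' : Q.Smooth f') :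
    Q.D A (fun w => f w - f' w) z = Q.D A f z - Q.D A f' z := by
  rw [D, fderiv_fun_sub (hf.differentiableAt hz) (hf'.differentiableAt hz)]; rfl

theorem D_mul (hz : z ∈ Q.E) (hf : Q.Smooth f) (hf' : Q.Smooth f') :
    Q.D A (fun w => f w * f' w) z = Q.D A f z * f' z + f z * Q.D A f' z := by
  rw [D, fderiv_fun_mul (hf.differentiableAt hz) (hf'.differentiableAt hz)]
  simp [D]; ring

theorem D_const_mul (hz : z ∈ Q.E) (c : ℝ) (hf : Q.Smooth f) :
    Q.D A (fun w => c * f w) z = c * Q.D A f z := by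
  rw [D_mul A hz (smooth_const c) hf, D_const]; ring

theorem D_sum (hz : z ∈ Q.E) {ι : Type*} {s : Finset ι} {F : ι → Jet p n → ℝ}
    (hF : ∀ i ∈ s, Q.Smooth (F i)) :
    Q.D A (fun w => ∑ i ∈ s, F i w) z = ∑ i ∈ s, Q.D A (F i) z := by
  rw [D, fderiv_fun_sum fun i hi => (hF i hi).differentiableAt hz]
  simp [D]

end Derivation

/-- The change of basis is unitriangular: only the vertical component is corrected, by M and N.
Spanning and linear independence of the frame are both read off from this formula. -/
theorem sum_smul_frame (a : Idx p n → ℝ) (z : Jet p n) :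
    ∑ K, a K • Q.frame K z = (fun α => a (Idx.t α), fun i => a (Idx.x i), fun i α =>
      a (Idx.v i α) - ∑ β, Q.M z i α β * a (Idx.t β) - ∑ j, Q.N z i α j * a (Idx.x j)) := by
  simp only [Fintype.sum_sum_type, Fintype.sum_prod_type, frame]
  refine Prod.ext ?_ (Prod.ext ?_ ?_)
  · funext b
    simp [Prod.fst_sum, Finset.sum_apply, Pi.single_apply]
  · funext b
    simp [Prod.fst_sum, Prod.snd_sum, Finset.sum_apply, Pi.single_apply]
  · funext i α
    have : ∀ x : Fin n, ∀ y : Fin p,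
        (Pi.single x (Pi.single y 1) : Fin n → Fin p → ℝ) i α
          = if i = x then (if α = y then 1 else 0) else 0 := by
      intro x y
      by_cases h : i = x
      · subst h; simp [Pi.single_apply]
      · simp [h]
    simp [Prod.snd_sum, Finset.sum_apply, this, mul_comm]
    ring

theorem sum_coframe_smul_frame (z w : Jet p n) : ∑ K, Q.coframe K z w • Q.frame K z = w := by
  rw [sum_smul_frame]
  refine Prod.ext rfl (Prod.ext rfl ?_)
  funext i α
  simp only [coframe]
  ring

theorem eq_zero_of_sum_smul_frame_eq_zero {a : Idx p n → ℝ} {z : Jet p n}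
    (h : ∑ K, a K • Q.frame K z = 0) (K : Idx p n) : a K = 0 := by
  rw [sum_smul_frame] at h
  have ht : ∀ α, a (Idx.t α) = 0 := fun α => congrFun (congrArg Prod.fst h) α
  have hx : ∀ i, a (Idx.x i) = 0 := fun i => congrFun (congrArg (fun w => w.2.1) h) i
  have hv := fun i α => congrFun (congrFun (congrArg (fun w => w.2.2) h) i) α
  simp only [ht, hx, mul_zero, Finset.sum_const_zero, sub_zero] at hv
  rcases K with α | i | ⟨i, α⟩
  exacts [ht α, hx i, hv i α]

/-- The components of the Lie bracket `[X_C, X_B]` in the adapted frame. -/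
noncomputable def bracket (Q : GMLSpace p n) (K C B : Idx p n) (z : Jet p n) : ℝ :=
  Q.coframe K z (VectorField.lieBracket ℝ (Q.frame C) (Q.frame B) z)

theorem coframe_neg (K : Idx p n) (z w : Jet p n) : Q.coframe K z (-w) = - Q.coframe K z w := by
  rcases K with α | i | ⟨i, α⟩ <;> simp [coframe]
  ring

theorem bracket_swap (K C B : Idx p n) (z : Jet p n) : Q.bracket K C B z = - Q.bracket K B C z := by
  rw [bracket, VectorField.lieBracket_swap]
  exact coframe_neg _ _ _

theorem contDiffOn_lieBracket_frame (C B : Idx p n) :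
    ContDiffOn ℝ ∞ (VectorField.lieBracket ℝ (Q.frame C) (Q.frame B)) Q.E := by
  have h : ∀ A B : Idx p n, ContDiffOn ℝ ∞ (fun z => fderiv ℝ (Q.frame A) z (Q.frame B z)) Q.E :=
    fun A B => ((contDiffOn_frame A).fderiv_of_isOpen (m := ∞) Q.isOpen_E (by simp)).clm_apply
      (contDiffOn_frame B)
  exact (h B C).sub (h C B)

theorem smooth_bracket (K C B : Idx p n) : Q.Smooth (Q.bracket K C B) := by
  have hl := contDiffOn_lieBracket_frame (Q := Q) C B
  have h1 : ∀ α, Q.Smooth fun z => (VectorField.lieBracket ℝ (Q.frame C) (Q.frame B) z).1 α :=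
    fun α => contDiffOn_pi.1 hl.fst α
  have h2 : ∀ i, Q.Smooth fun z => (VectorField.lieBracket ℝ (Q.frame C) (Q.frame B) z).2.1 i :=
    fun i => contDiffOn_pi.1 hl.snd.fst i
  have h3 : ∀ i α,
      Q.Smooth fun z => (VectorField.lieBracket ℝ (Q.frame C) (Q.frame B) z).2.2 i α :=
    fun i α => contDiffOn_pi.1 (contDiffOn_pi.1 hl.snd.snd i) α
  rcases K with α | i | ⟨i, α⟩
  · exact h1 α
  · exact h2 i
  · exact ((h3 i α).add (Smooth.sum fun β _ => (smooth_M i α β).mul (h1 β))).add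
      (Smooth.sum fun j _ => (smooth_N i α j).mul (h2 j))

theorem fderiv_frame_fst (A : Idx p n) {z : Jet p n} (hz : z ∈ Q.E) (w : Jet p n) :
    (fderiv ℝ (Q.frame A) z w).1 = 0 := by
  have h : HasFDerivAt (fun w => (Q.frame A w).1) _ z := (differentiableAt_frame A hz).hasFDerivAt.fst
  have h' : HasFDerivAt (fun w => (Q.frame A w).1) (0 : Jet p n →L[ℝ] (Fin p → ℝ)) z := by
    rcases A with α | i | ⟨i, α⟩ <;> exact hasFDerivAt_const _ _
  exact DFunLike.congr_fun (h.unique h') w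

theorem fderiv_frame_snd_fst (A : Idx p n) {z : Jet p n} (hz : z ∈ Q.E) (w : Jet p n) :
    (fderiv ℝ (Q.frame A) z w).2.1 = 0 := by
  have h : HasFDerivAt (fun w => (Q.frame A w).2.1) _ z :=
    (differentiableAt_frame A hz).hasFDerivAt.snd.fst
  have h' : HasFDerivAt (fun w => (Q.frame A w).2.1) (0 : Jet p n →L[ℝ] (Fin n → ℝ)) z := by
    rcases A with α | i | ⟨i, α⟩ <;> exact hasFDerivAt_const _ _
  exact DFunLike.congr_fun (h.unique h') w

/-- The temporal and spatial components of every frame field are constant, so a bracket of frame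
fields has only vertical components. -/
theorem bracket_t (α : Fin p) (C B : Idx p n) {z : Jet p n} (hz : z ∈ Q.E) :
    Q.bracket (Idx.t α) C B z = 0 := by
  simp [bracket, coframe, VectorField.lieBracket, fderiv_frame_fst _ hz]

theorem bracket_x (i : Fin n) (C B : Idx p n) {z : Jet p n} (hz : z ∈ Q.E) :
    Q.bracket (Idx.x i) C B z = 0 := by
  simp [bracket, coframe, VectorField.lieBracket, fderiv_frame_snd_fst _ hz]

/-- The second derivative of f is symmetric, so in the commutator only the terms differentiating the
frame fields survive; they form the Lie bracket, which is then expanded in the frame. -/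
theorem D_D_sub (C B : Idx p n) {f : Jet p n → ℝ} (hf : Q.Smooth f) {z : Jet p n} (hz : z ∈ Q.E) :
    Q.D C (Q.D B f) z - Q.D B (Q.D C f) z = ∑ K, Q.bracket K C B z * Q.D K f z := by
  have hd : DifferentiableAt ℝ (fderiv ℝ f) z :=
    ((ContDiffOn.fderiv_of_isOpen hf (m := ∞) Q.isOpen_E (by simp)).differentiableOn
      (by simp)).differentiableAt (Q.isOpen_E.mem_nhds hz)
  have hD : ∀ C B, Q.D C (Q.D B f) z = fderiv ℝ (fderiv ℝ f) z (Q.frame C z) (Q.frame B z)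
      + fderiv ℝ f z (fderiv ℝ (Q.frame B) z (Q.frame C z)) := by
    intro C B
    change fderiv ℝ (fun w => fderiv ℝ f w (Q.frame B w)) z (Q.frame C z) = _
    rw [fderiv_clm_apply hd (differentiableAt_frame B hz)]
    simp [add_comm]
  have hs : IsSymmSndFDerivAt ℝ f z :=
    (ContDiffOn.contDiffAt hf (Q.isOpen_E.mem_nhds hz)).isSymmSndFDerivAt
      (by rw [minSmoothness_of_isRCLikeNormedField]; exact WithTop.coe_le_coe.2 (le_top : (2 : ℕ∞) ≤ ⊤))
  have hb : ∑ K, Q.bracket K C B z * Q.D K f z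
      = fderiv ℝ f z (VectorField.lieBracket ℝ (Q.frame C) (Q.frame B) z) := by
    conv_rhs => rw [← sum_coframe_smul_frame (Q := Q) z
      (VectorField.lieBracket ℝ (Q.frame C) (Q.frame B) z)]
    simp [D, bracket]
  rw [hb, hD, hD, hs.eq (Q.frame C z) (Q.frame B z), VectorField.lieBracket, map_sub]
  ring

/-- Both sides are the double commutator [D', [C, B]] applied to f. The cyclic sum of the right side
vanishes identically, which is the source of the Jacobi identity. -/
theorem sum_bracket_mul_D (C B : Idx p n) (D' : Idx p n) {f : Jet p n → ℝ} (hf : Q.Smooth f)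
    {z : Jet p n} (hz : z ∈ Q.E) :
    ∑ K, (Q.D D' (Q.bracket K C B) z * Q.D K f z
        + Q.bracket K C B z * ∑ F, Q.bracket F D' K z * Q.D F f z)
      = Q.D D' (Q.D C (Q.D B f)) z - Q.D D' (Q.D B (Q.D C f)) z
        - (Q.D C (Q.D B (Q.D D' f)) z - Q.D B (Q.D C (Q.D D' f)) z) := by
  rw [D_D_sub C B (hf.D D') hz, ← D_sub D' hz ((hf.D B).D C) ((hf.D C).D B),
    D_congr D' hz fun w hw => D_D_sub C B hf hw,
    D_sum D' hz fun K _ => (smooth_bracket K C B).mul (hf.D K), ← Finset.sum_sub_distrib]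
  refine Finset.sum_congr rfl fun K _ => ?_
  rw [D_mul D' hz (smooth_bracket K C B) (hf.D K), ← D_D_sub D' K hf hz]
  ring

/-- The Jacobi identity for the structure functions of the adapted frame. -/
theorem bracket_jacobi (B C D' : Idx p n) {z : Jet p n} (hz : z ∈ Q.E) (F : Idx p n) :
    (Q.D D' (Q.bracket F C B) z + ∑ K, Q.bracket K C B z * Q.bracket F D' K z)
      + (Q.D C (Q.bracket F B D') z + ∑ K, Q.bracket K B D' z * Q.bracket F C K z)
      + (Q.D B (Q.bracket F D' C) z + ∑ K, Q.bracket K D' C z * Q.bracket F B K z) = 0 := by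
  have key : ∀ f, Q.Smooth f → ∀ C B D', ∑ K, (Q.D D' (Q.bracket K C B) z
      + ∑ K', Q.bracket K' C B z * Q.bracket K D' K' z) * Q.D K f z
      = Q.D D' (Q.D C (Q.D B f)) z - Q.D D' (Q.D B (Q.D C f)) z
        - (Q.D C (Q.D B (Q.D D' f)) z - Q.D B (Q.D C (Q.D D' f)) z) := by
    intro f hf C B D'
    rw [← sum_bracket_mul_D C B D' hf hz]
    simp only [add_mul, Finset.sum_add_distrib, Finset.sum_mul, Finset.mul_sum]
    congr 1
    rw [Finset.sum_comm]
    simp only [mul_assoc]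
  refine eq_zero_of_sum_smul_frame_eq_zero (Q := Q) (z := z) (a := fun F => 
    (Q.D D' (Q.bracket F C B) z + ∑ K, Q.bracket K C B z * Q.bracket F D' K z)
      + (Q.D C (Q.bracket F B D') z + ∑ K, Q.bracket K B D' z * Q.bracket F C K z)
      + (Q.D B (Q.bracket F D' C) z + ∑ K, Q.bracket K D' C z * Q.bracket F B K z)) ?_ F
  -- Linear functionals suffice as test functions: they separate vectors, and the frame is linearly
  -- independent, so each coefficient vanishes.
  have hl : ∀ l : Jet p n →L[ℝ] ℝ, ∀ K, Q.D K l z = l (Q.frame K z) := fun l K => by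
    simp [D]
  refine SeparatingDual.eq_zero_of_forall_dual_eq_zero (R := ℝ) fun l => ?_
  have hsm : Q.Smooth l := l.contDiff.contDiffOn
  have h1 := key l hsm C B D'
  have h2 := key l hsm B D' C
  have h3 := key l hsm D' C B
  simp only [map_sum, map_smul, smul_eq_mul, ← hl]
  simp only [add_mul _ _ (Q.D _ _ _), Finset.sum_add_distrib] at h1 h2 h3 ⊢
  linarith

end GMLSpace

/-! ### Matrix-valued functions, curvature of a linear connection, second Bianchi identity. -/

namespace GMLSpace

variable {p n : ℕ} {Q : GMLSpace p n} {ι : Type*}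

/-- Matrix functions with smooth entries. -/
def MSmooth (Q : GMLSpace p n) (W : Jet p n → Matrix ι ι ℝ) : Prop :=
  ∀ i j, Q.Smooth fun z => W z i j

/-- The entrywise derivative of a matrix function along the adapted frame. -/
noncomputable def DM (Q : GMLSpace p n) (A : Idx p n) (W : Jet p n → Matrix ι ι ℝ)
    (z : Jet p n) : Matrix ι ι ℝ :=
  Matrix.of fun i j => Q.D A (fun w => W w i j) z

section

variable {W W' : Jet p n → Matrix ι ι ℝ} {z : Jet p n} (A : Idx p n)

theorem MSmooth.add (hW : Q.MSmooth W) (hW' : Q.MSmooth W') : Q.MSmooth fun z => W z + W' z :=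
  fun i j => (hW i j).add (hW' i j)

theorem MSmooth.sub (hW : Q.MSmooth W) (hW' : Q.MSmooth W') : Q.MSmooth fun z => W z - W' z :=
  fun i j => (hW i j).sub (hW' i j)

theorem MSmooth.mul [Fintype ι] (hW : Q.MSmooth W) (hW' : Q.MSmooth W') : Q.MSmooth fun z => W z * W' z :=
  fun i j => by
    simp only [Matrix.mul_apply]
    exact Smooth.sum fun k _ => (hW i k).mul (hW' k j)

theorem MSmooth.smul {f : Jet p n → ℝ} (hf : Q.Smooth f) (hW : Q.MSmooth W) :
    Q.MSmooth fun z => f z • W z :=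
  fun i j => hf.mul (hW i j)

theorem MSmooth.sum {κ : Type*} {s : Finset κ} {W : κ → Jet p n → Matrix ι ι ℝ}
    (hW : ∀ k ∈ s, Q.MSmooth (W k)) : Q.MSmooth fun z => ∑ k ∈ s, W k z :=
  fun i j => by
    simp only [Matrix.sum_apply]
    exact Smooth.sum fun k hk => hW k hk i j

theorem MSmooth.transpose (hW : Q.MSmooth W) : Q.MSmooth fun z => (W z).transpose :=
  fun i j => hW j i

theorem MSmooth.DM (hW : Q.MSmooth W) : Q.MSmooth (Q.DM A W) := fun i j => (hW i j).D A

theorem DM_congr (hz : z ∈ Q.E) (h : ∀ w ∈ Q.E, W w = W' w) : Q.DM A W z = Q.DM A W' z := by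
  ext i j
  exact D_congr A hz fun w hw => by rw [h w hw]

theorem DM_add (hz : z ∈ Q.E) (hW : Q.MSmooth W) (hW' : Q.MSmooth W') :
    Q.DM A (fun w => W w + W' w) z = Q.DM A W z + Q.DM A W' z := by
  ext i j
  exact D_add A hz (hW i j) (hW' i j)

theorem DM_sub (hz : z ∈ Q.E) (hW : Q.MSmooth W) (hW' : Q.MSmooth W') :
    Q.DM A (fun w => W w - W' w) z = Q.DM A W z - Q.DM A W' z := by
  ext i j
  exact D_sub A hz (hW i j) (hW' i j)

theorem DM_mul [Fintype ι] (hz : z ∈ Q.E) (hW : Q.MSmooth W) (hW' : Q.MSmooth W') :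
    Q.DM A (fun w => W w * W' w) z = Q.DM A W z * W' z + W z * Q.DM A W' z := by
  ext i j
  simp only [DM, Matrix.of_apply, Matrix.add_apply, Matrix.mul_apply]
  rw [D_sum A hz fun k _ => (hW i k).mul (hW' k j), ← Finset.sum_add_distrib]
  exact Finset.sum_congr rfl fun k _ => D_mul A hz (hW i k) (hW' k j)

theorem DM_smul {f : Jet p n → ℝ} (hz : z ∈ Q.E) (hf : Q.Smooth f) (hW : Q.MSmooth W) :
    Q.DM A (fun w => f w • W w) z = Q.D A f z • W z + f z • Q.DM A W z := by
  ext i j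
  exact D_mul A hz hf (hW i j)

theorem DM_sum {κ : Type*} {s : Finset κ} {W : κ → Jet p n → Matrix ι ι ℝ} (hz : z ∈ Q.E)
    (hW : ∀ k ∈ s, Q.MSmooth (W k)) :
    Q.DM A (fun w => ∑ k ∈ s, W k w) z = ∑ k ∈ s, Q.DM A (W k) z := by
  ext i j
  simp only [DM, Matrix.of_apply, Matrix.sum_apply]
  exact D_sum A hz fun k hk => hW k hk i j

theorem DM_transpose : Q.DM A (fun w => (W w).transpose) z = (Q.DM A W z).transpose := rfl

theorem DM_const (M : Matrix ι ι ℝ) : Q.DM A (fun _ => M) z = 0 := by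
  ext i j
  exact D_const A _

theorem DM_DM_sub (C B : Idx p n) (hW : Q.MSmooth W) (hz : z ∈ Q.E) :
    Q.DM C (Q.DM B W) z - Q.DM B (Q.DM C W) z = ∑ K, Q.bracket K C B z • Q.DM K W z := by
  ext i j
  simp only [Matrix.sum_apply, Matrix.sub_apply, Matrix.smul_apply, smul_eq_mul]
  exact D_D_sub C B (hW i j) hz

end

/-- The curvature `[∇_C, ∇_B] - ∇_{[X_C, X_B]}` of the connection with matrices `θ A` in the
adapted frame. -/
noncomputable def curvOf [Fintype ι] (Q : GMLSpace p n) (θ : Idx p n → Jet p n → Matrix ι ι ℝ)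
    (B C : Idx p n) (z : Jet p n) : Matrix ι ι ℝ :=
  Q.DM C (θ B) z - Q.DM B (θ C) z + (θ C z * θ B z - θ B z * θ C z)
    - ∑ K, Q.bracket K C B z • θ K z

section Curvature

variable [Fintype ι] {θ : Idx p n → Jet p n → Matrix ι ι ℝ} {z : Jet p n}

theorem curvOf_swap (B C : Idx p n) : Q.curvOf θ B C z = - Q.curvOf θ C B z := by
  simp only [curvOf, bracket_swap _ C B, neg_smul, Finset.sum_neg_distrib]
  abel

theorem mSmooth_curvOf (hθ : ∀ A, Q.MSmooth (θ A)) (B C : Idx p n) : Q.MSmooth (Q.curvOf θ B C) :=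
  ((((hθ B).DM C).sub ((hθ C).DM B)).add (((hθ C).mul (hθ B)).sub ((hθ B).mul (hθ C)))).sub
    (MSmooth.sum fun K _ => (hθ K).smul (smooth_bracket K C B))

theorem DM_curvOf (hθ : ∀ A, Q.MSmooth (θ A)) (hz : z ∈ Q.E) (B C F : Idx p n) :
    Q.DM F (Q.curvOf θ B C) z =
      Q.DM F (Q.DM C (θ B)) z - Q.DM F (Q.DM B (θ C)) z
      + (Q.DM F (θ C) z * θ B z + θ C z * Q.DM F (θ B) z
        - (Q.DM F (θ B) z * θ C z + θ B z * Q.DM F (θ C) z))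
      - ∑ K, (Q.D F (Q.bracket K C B) z • θ K z + Q.bracket K C B z • Q.DM F (θ K) z) := by
  have h1 := (hθ B).DM C
  have h2 := (hθ C).DM B
  have h3 := (hθ C).mul (hθ B)
  have h4 := (hθ B).mul (hθ C)
  have h5 : ∀ K ∈ Finset.univ, Q.MSmooth fun z => Q.bracket K C B z • θ K z :=
    fun K _ => (hθ K).smul (smooth_bracket K C B)
  unfold curvOf
  rw [DM_sub F hz ((h1.sub h2).add (h3.sub h4)) (MSmooth.sum h5),
    DM_add F hz (h1.sub h2) (h3.sub h4), DM_sub F hz h1 h2, DM_sub F hz h3 h4,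
    DM_mul F hz (hθ C) (hθ B), DM_mul F hz (hθ B) (hθ C), DM_sum F hz h5]
  congr 1
  exact Finset.sum_congr rfl fun K _ => DM_smul F hz (smooth_bracket K C B) (hθ K)

/-- The second Bianchi identity in the (anholonomic) adapted frame. -/
theorem curvOf_bianchi (hθ : ∀ A, Q.MSmooth (θ A)) (hz : z ∈ Q.E)
    (B C F : Idx p n) :
    (Q.DM F (Q.curvOf θ B C) z + θ F z * Q.curvOf θ B C z - Q.curvOf θ B C z * θ F z
        + ∑ K, Q.bracket K C B z • Q.curvOf θ K F z)
      + (Q.DM C (Q.curvOf θ F B) z + θ C z * Q.curvOf θ F B z - Q.curvOf θ F B z * θ C z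
        + ∑ K, Q.bracket K B F z • Q.curvOf θ K C z)
      + (Q.DM B (Q.curvOf θ C F) z + θ B z * Q.curvOf θ C F z - Q.curvOf θ C F z * θ B z
        + ∑ K, Q.bracket K F C z • Q.curvOf θ K B z) = 0 := by
  -- The terms in the undifferentiated matrices with quadratic or differentiated structure functions
  -- collect into the Jacobi identity.
  have hJ : ∑ L, ((Q.D F (Q.bracket L C B) z + ∑ K, Q.bracket K C B z * Q.bracket L F K z)
      + (Q.D C (Q.bracket L B F) z + ∑ K, Q.bracket K B F z * Q.bracket L C K z)
      + (Q.D B (Q.bracket L F C) z + ∑ K, Q.bracket K F C z * Q.bracket L B K z)) • θ L z = 0 :=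
    Finset.sum_eq_zero fun L _ => by rw [bracket_jacobi B C F hz L, zero_smul]
  -- In this expansion the sum of bracket times `DM K (θ F)` is the commutator of second derivatives
  -- of `θ F`, which cancels against the second derivatives produced by `DM_curvOf`.
  have hexp : ∀ B C F, ∑ K, Q.bracket K C B z • Q.curvOf θ K F z
      = (∑ K, Q.bracket K C B z • Q.DM F (θ K) z) - (∑ K, Q.bracket K C B z • Q.DM K (θ F) z)
        + (θ F z * (∑ K, Q.bracket K C B z • θ K z) - (∑ K, Q.bracket K C B z • θ K z) * θ F z)
        - ∑ L, (∑ K, Q.bracket K C B z * Q.bracket L F K z) • θ L z := by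
    intro B C F
    have : ∑ L, (∑ K, Q.bracket K C B z * Q.bracket L F K z) • θ L z
        = ∑ K, Q.bracket K C B z • ∑ L, Q.bracket L F K z • θ L z := by
      simp only [Finset.sum_smul, Finset.smul_sum, smul_smul]
      exact Finset.sum_comm
    rw [this]
    simp only [curvOf, smul_sub, smul_add, Finset.sum_sub_distrib, Finset.sum_add_distrib,
      Finset.mul_sum, Finset.sum_mul, mul_smul_comm, smul_mul_assoc]
  rw [DM_curvOf hθ hz, DM_curvOf hθ hz, DM_curvOf hθ hz, hexp, hexp, hexp,
    ← DM_DM_sub C B (hθ F) hz, ← DM_DM_sub B F (hθ C) hz, ← DM_DM_sub F C (hθ B) hz]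
  simp only [add_smul, Finset.sum_add_distrib] at hJ ⊢
  rw [← neg_eq_zero, ← hJ]
  simp only [curvOf]
  noncomm_ring

end Curvature

end GMLSpace

/-! ### Contraction of the cyclic identity. -/

open Finset in
/-- The contraction of a cyclic identity for a curvature-like array with both upper and lower
indices skew: `V l j q k` stands for `V^{lj}_{qk}`, `dV m` for its derivatives and `Γ a b m` for
symmetric connection coefficients. -/
theorem contracted_cyclic_identity {ι : Type*} [Fintype ι] (V : ι → ι → ι → ι → ℝ)
    (dV : ι → ι → ι → ι → ι → ℝ) (Γ : ι → ι → ι → ℝ)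
    (hΓ : ∀ a b m, Γ a b m = Γ a m b)
    (hup : ∀ l j q k, V l j q k = - V j l q k) (hlow : ∀ l j q k, V l j q k = - V l j k q)
    (dup : ∀ m l j q k, dV m l j q k = - dV m j l q k)
    (dlow : ∀ m l j q k, dV m l j q k = - dV m l j k q)
    (hcyc : ∀ l j q k m,
      (dV m l j q k + ∑ a, Γ l a m * V a j q k + ∑ a, Γ j a m * V l a q k)
      + (dV k l j m q + ∑ a, Γ l a k * V a j m q + ∑ a, Γ j a k * V l a m q)
      + (dV q l j k m + ∑ a, Γ l a q * V a j k m + ∑ a, Γ j a q * V l a k m) = 0) (k : ι) :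
    ∑ m, (∑ l, dV m l m k l + ∑ a, Γ m a m * ∑ l, V l a k l - ∑ a, Γ a k m * ∑ l, V l m a l)
      = (1 / 2) * ∑ j, ∑ l, dV k l j j l := by
  -- Used for the terms pairing the symmetric Γ with two skew upper indices.
  have hskew : ∀ f : ι → ι → ℝ, (∀ a b, f a b = - f b a) → ∑ a, ∑ b, f a b = 0 := by
    intro f hf
    have h : ∑ a, ∑ b, f a b = - ∑ a, ∑ b, f a b := by
      conv_lhs => rw [sum_comm]
      simp only [← sum_neg_distrib]
      exact sum_congr rfl fun a _ => sum_congr rfl fun b _ => hf b a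
    linarith
  have e1 : ∑ m, ∑ q, dV m m q q k = ∑ m, ∑ l, dV m l m k l :=
    sum_congr rfl fun m _ => sum_congr rfl fun q _ => by rw [dup, dlow, neg_neg]
  have e2 : ∑ m, ∑ q, ∑ a, Γ m a m * V a q q k = ∑ m, ∑ a, Γ m a m * ∑ l, V l a k l := by
    refine sum_congr rfl fun m _ => ?_
    rw [sum_comm]
    refine sum_congr rfl fun a _ => ?_
    rw [mul_sum]
    exact sum_congr rfl fun q _ => by rw [hup, hlow, neg_neg]
  have e3 : ∑ m, ∑ q, ∑ a, Γ q a m * V m a q k = 0 := by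
    rw [sum_comm]
    refine sum_eq_zero fun q _ => hskew _ fun m a => ?_
    rw [hΓ q a m, hup m a]; ring
  have e4 : ∑ m, ∑ q, dV k m q m q = - ∑ j, ∑ l, dV k l j j l := by
    rw [sum_comm]
    simp only [← sum_neg_distrib]
    exact sum_congr rfl fun q _ => sum_congr rfl fun m _ => dlow _ _ _ _ _
  -- The cyclic identity has no connection terms for lower indices. Symmetry of Γ converts the
  -- upper-index terms of the k-derivative into the lower-index correction of the divergence, here
  -- and in `e6`.
  have e5 : ∑ m, ∑ q, ∑ a, Γ m a k * V a q m q = - ∑ m, ∑ a, Γ a k m * ∑ l, V l m a l := by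
    simp only [← sum_neg_distrib, mul_sum]
    calc _ = ∑ m, ∑ a, ∑ q, Γ m a k * V a q m q := sum_congr rfl fun m _ => sum_comm
      _ = ∑ a, ∑ m, ∑ q, Γ m a k * V a q m q := sum_comm
      _ = _ := sum_congr rfl fun a _ => sum_congr rfl fun m _ => by
        exact sum_congr rfl fun q _ => by rw [hΓ m a k, hup a q]; ring
  have e6 : ∑ m, ∑ q, ∑ a, Γ q a k * V m a m q = - ∑ m, ∑ a, Γ a k m * ∑ l, V l m a l := by
    simp only [← sum_neg_distrib, mul_sum]
    calc _ = ∑ q, ∑ m, ∑ a, Γ q a k * V m a m q := sum_comm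
      _ = ∑ q, ∑ a, ∑ m, Γ q a k * V m a m q := sum_congr rfl fun q _ => sum_comm
      _ = ∑ a, ∑ q, ∑ m, Γ q a k * V m a m q := sum_comm
      _ = _ := sum_congr rfl fun a _ => sum_congr rfl fun q _ => by
        exact sum_congr rfl fun m _ => by rw [hΓ q a k, hlow m a]; ring
  have e7 : ∑ m, ∑ q, dV q m q k m = ∑ m, ∑ l, dV m l m k l := sum_comm
  have e8 : ∑ m, ∑ q, ∑ a, Γ m a q * V a q k m = 0 := by
    refine sum_eq_zero fun m _ => hskew _ fun q a => ?_
    rw [hΓ m a q, hup a q]; ring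
  have e9 : ∑ m, ∑ q, ∑ a, Γ q a q * V m a k m = ∑ m, ∑ a, Γ m a m * ∑ l, V l a k l := by
    rw [sum_comm]
    refine sum_congr rfl fun q _ => ?_
    rw [sum_comm]
    exact sum_congr rfl fun a _ => by rw [mul_sum]
  -- Contracting l with m and j with q gives twice the divergence minus the gradient of the full
  -- trace, whence the factor 1/2.
  have h : ∑ m, ∑ q, ((dV m m q q k + ∑ a, Γ m a m * V a q q k + ∑ a, Γ q a m * V m a q k)
      + (dV k m q m q + ∑ a, Γ m a k * V a q m q + ∑ a, Γ q a k * V m a m q)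
      + (dV q m q k m + ∑ a, Γ m a q * V a q k m + ∑ a, Γ q a q * V m a k m)) = 0 :=
    sum_eq_zero fun m _ => sum_eq_zero fun q _ => hcyc m q q k m
  simp only [sum_add_distrib, sum_sub_distrib, e1, e2, e3, e4, e5, e6, e7, e8, e9] at h ⊢
  linarith

/-! ### Metric connections and the contracted second Bianchi identity. -/

namespace GMLSpace

variable {p n : ℕ} {Q : GMLSpace p n} {ι : Type*} [Fintype ι] [DecidableEq ι]
  {θ : Idx p n → Jet p n → Matrix ι ι ℝ} {G : Jet p n → Matrix ι ι ℝ}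

/-- The connection with matrices `θ` preserves the bilinear form `G`. -/
def IsMetric (Q : GMLSpace p n) (θ : Idx p n → Jet p n → Matrix ι ι ℝ)
    (G : Jet p n → Matrix ι ι ℝ) : Prop :=
  ∀ z ∈ Q.E, ∀ A, Q.DM A G z = (θ A z).transpose * G z + G z * θ A z

/-- Differentiate metricity a second time and antisymmetrize in B and C: the mixed terms cancel, and
the commutator on G supplies the bracket part of the curvature. -/
theorem IsMetric.curvOf_skew (hm : Q.IsMetric θ G) (hθ : ∀ A, Q.MSmooth (θ A)) (hG : Q.MSmooth G)
    {z : Jet p n} (hz : z ∈ Q.E) (B C : Idx p n) :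
    (Q.curvOf θ B C z).transpose * G z + G z * Q.curvOf θ B C z = 0 := by
  have hDD : ∀ C B, Q.DM C (Q.DM B G) z =
      (Q.DM C (θ B) z).transpose * G z
        + (θ B z).transpose * ((θ C z).transpose * G z + G z * θ C z)
        + (((θ C z).transpose * G z + G z * θ C z) * θ B z + G z * Q.DM C (θ B) z) := by
    intro C B
    have h1 := (hθ B).transpose.mul hG
    have h2 := hG.mul (hθ B)
    rw [DM_congr C hz fun w hw => hm w hw B, DM_add C hz h1 h2,
      DM_mul C hz (hθ B).transpose hG, DM_mul C hz hG (hθ B), DM_transpose, hm z hz C]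
  have h := DM_DM_sub C B hG hz
  have hs : ∑ K, Q.bracket K C B z • Q.DM K G z
      = (∑ K, Q.bracket K C B z • θ K z).transpose * G z
        + G z * ∑ K, Q.bracket K C B z • θ K z := by
    simp only [hm z hz, Matrix.transpose_sum, Matrix.transpose_smul, Finset.sum_mul,
      Finset.mul_sum, smul_mul_assoc, mul_smul_comm, smul_add, Finset.sum_add_distrib]
  rw [hDD, hDD, hs, ← sub_eq_zero] at h
  rw [← h]
  simp only [curvOf, Matrix.transpose_sub, Matrix.transpose_add, Matrix.transpose_mul]
  noncomm_ring

theorem mSmooth_inv (hG : Q.MSmooth G) (hdet : ∀ z ∈ Q.E, (G z).det ≠ 0) :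
    Q.MSmooth fun z => (G z)⁻¹ := fun i j => smooth_inv hG hdet i j

theorem IsMetric.DM_inv (hm : Q.IsMetric θ G) (hG : Q.MSmooth G)
    (hdet : ∀ z ∈ Q.E, (G z).det ≠ 0) {z : Jet p n} (hz : z ∈ Q.E) (A : Idx p n) :
    Q.DM A (fun w => (G w)⁻¹) z = - ((G z)⁻¹ * (θ A z).transpose) - θ A z * (G z)⁻¹ := by
  have hu : ∀ w ∈ Q.E, IsUnit (G w).det := fun w hw => (hdet w hw).isUnit
  have h : Q.DM A (fun w => G w * (G w)⁻¹) z = 0 := by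
    rw [DM_congr A hz fun w hw => Matrix.mul_nonsing_inv _ (hu w hw), DM_const]
  rw [DM_mul A hz hG (mSmooth_inv hG hdet), hm z hz] at h
  have h' := congrArg ((G z)⁻¹ * ·) h
  simp only [mul_add, add_mul, mul_zero, Matrix.mul_assoc, Matrix.mul_nonsing_inv _ (hu z hz),
    Matrix.nonsing_inv_mul_cancel_left _ _ (hu z hz), mul_one] at h'
  rw [← sub_eq_zero, ← h']
  abel

/-- The curvature with the lower matrix index raised. -/
noncomputable def raisedCurv (Q : GMLSpace p n) (θ : Idx p n → Jet p n → Matrix ι ι ℝ)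
    (G : Jet p n → Matrix ι ι ℝ) (B C : Idx p n) (z : Jet p n) : Matrix ι ι ℝ :=
  Q.curvOf θ B C z * (G z)⁻¹

theorem mSmooth_raisedCurv (hθ : ∀ A, Q.MSmooth (θ A)) (hG : Q.MSmooth G)
    (hdet : ∀ z ∈ Q.E, (G z).det ≠ 0) (B C : Idx p n) : Q.MSmooth (Q.raisedCurv θ G B C) :=
  (mSmooth_curvOf hθ B C).mul (mSmooth_inv hG hdet)

theorem raisedCurv_swap (B C : Idx p n) (z : Jet p n) :
    Q.raisedCurv θ G B C z = - Q.raisedCurv θ G C B z := by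
  rw [raisedCurv, curvOf_swap, neg_mul]; rfl

theorem IsMetric.raisedCurv_skew (hm : Q.IsMetric θ G) (hθ : ∀ A, Q.MSmooth (θ A))
    (hG : Q.MSmooth G) (hsymm : ∀ z ∈ Q.E, (G z).IsSymm) (hdet : ∀ z ∈ Q.E, (G z).det ≠ 0)
    {z : Jet p n} (hz : z ∈ Q.E) (B C : Idx p n) (l j : ι) :
    Q.raisedCurv θ G B C z l j = - Q.raisedCurv θ G B C z j l := by
  have hu := (hdet z hz).isUnit
  have h := congrArg (fun W => (G z)⁻¹ * W * (G z)⁻¹) (hm.curvOf_skew hθ hG hz B C)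
  simp only [mul_add, add_mul, mul_zero, zero_mul, Matrix.mul_assoc,
    Matrix.mul_nonsing_inv _ hu, mul_one, Matrix.nonsing_inv_mul_cancel_left _ _ hu] at h
  have ht : (G z)⁻¹ * (Q.curvOf θ B C z).transpose = (Q.raisedCurv θ G B C z).transpose := by
    rw [raisedCurv, Matrix.transpose_mul, Matrix.transpose_nonsing_inv, (hsymm z hz).eq]
  rw [ht] at h
  have h' := congrFun (congrFun h j) l
  simp only [Matrix.add_apply, Matrix.transpose_apply, Matrix.zero_apply] at h'
  change _ + Q.raisedCurv θ G B C z j l = 0 at h'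
  linarith

/-- The contracted second Bianchi identity for a metric connection on a bundle indexed by `ι`,
along frame directions `e i` whose torsion does not contribute. -/
theorem IsMetric.contracted_bianchi (hm : Q.IsMetric θ G) (hθ : ∀ A, Q.MSmooth (θ A))
    (hG : Q.MSmooth G) (hsymm : ∀ z ∈ Q.E, (G z).IsSymm) (hdet : ∀ z ∈ Q.E, (G z).det ≠ 0)
    (e : ι → Idx p n) {z : Jet p n} (hz : z ∈ Q.E)
    (htor : ∀ a b c, θ (e c) z a b = θ (e b) z a c)
    (hvan : ∀ q k m, ∑ K, Q.bracket K (e k) (e q) z • Q.curvOf θ K (e m) z = 0) (k : ι) :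
    ∑ m, (Q.D (e m) (fun w => ∑ l, Q.raisedCurv θ G (e k) (e l) w l m) z
        + ∑ a, θ (e m) z m a * ∑ l, Q.raisedCurv θ G (e k) (e l) z l a
        - ∑ a, θ (e m) z a k * ∑ l, Q.raisedCurv θ G (e a) (e l) z l m)
      = (1 / 2) * Q.D (e k) (fun w => ∑ j, ∑ l, Q.raisedCurv θ G (e j) (e l) w l j) z := by
  have hS := mSmooth_raisedCurv hθ hG hdet
  have hDneg : ∀ A {f f' : Jet p n → ℝ}, Q.Smooth f' → (∀ w ∈ Q.E, f w = - f' w) →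
      Q.D A f z = - Q.D A f' z := by
    intro A f f' hf' hff
    rw [D_congr A hz (f' := fun w => (-1) * f' w) fun w hw => by rw [hff w hw]; ring,
      D_const_mul A hz _ hf']
    ring
  have hcyc : ∀ q k m,
      (Q.DM (e m) (Q.raisedCurv θ G (e q) (e k)) z + θ (e m) z * Q.raisedCurv θ G (e q) (e k) z
        + Q.raisedCurv θ G (e q) (e k) z * (θ (e m) z).transpose)
      + (Q.DM (e k) (Q.raisedCurv θ G (e m) (e q)) z + θ (e k) z * Q.raisedCurv θ G (e m) (e q) z
        + Q.raisedCurv θ G (e m) (e q) z * (θ (e k) z).transpose)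
      + (Q.DM (e q) (Q.raisedCurv θ G (e k) (e m)) z + θ (e q) z * Q.raisedCurv θ G (e k) (e m) z
        + Q.raisedCurv θ G (e k) (e m) z * (θ (e q) z).transpose) = 0 := by
    intro q k m
    have hb := curvOf_bianchi hθ hz (e q) (e k) (e m)
    rw [hvan, hvan, hvan] at hb
    -- Since the inverse of G is parallel, multiplying the Bianchi identity by it turns the right
    -- multiplication by -θ into a connection term for the second upper index.
    have hD : ∀ A B C, Q.DM A (Q.raisedCurv θ G B C) z
        = Q.DM A (Q.curvOf θ B C) z * (G z)⁻¹
          + Q.curvOf θ B C z * (- ((G z)⁻¹ * (θ A z).transpose) - θ A z * (G z)⁻¹) := by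
      intro A B C
      rw [← hm.DM_inv hG hdet hz]
      exact DM_mul A hz (mSmooth_curvOf hθ B C) (mSmooth_inv hG hdet)
    have hb' := congrArg (· * (G z)⁻¹) hb
    simp only [zero_mul] at hb'
    rw [hD, hD, hD, ← hb']
    simp only [raisedCurv]
    noncomm_ring
  have := contracted_cyclic_identity (fun l j q k => Q.raisedCurv θ G (e q) (e k) z l j)
    (fun m l j q k => Q.D (e m) (fun w => Q.raisedCurv θ G (e q) (e k) w l j) z)
    (fun a b m => θ (e m) z a b) (fun a b m => htor a b m)
    (fun l j q k => hm.raisedCurv_skew hθ hG hsymm hdet hz _ _ l j)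
    (fun l j q k => by rw [raisedCurv_swap]; rfl)
    (fun m l j q k => hDneg _ (hS _ _ _ _) fun w hw =>
      hm.raisedCurv_skew hθ hG hsymm hdet hw _ _ l j)
    (fun m l j q k => hDneg _ (hS _ _ _ _) fun w hw => by rw [raisedCurv_swap]; rfl)
    (fun l j q k m => by
      have h := congrFun (congrFun (hcyc q k m) l) j
      simp only [Matrix.add_apply, Matrix.mul_apply, Matrix.transpose_apply, Matrix.zero_apply,
        DM, Matrix.of_apply] at h
      rw [← h]
      simp only [mul_comm])
    k
  rw [D_sum (e k) hz fun j _ => Smooth.sum fun l _ => hS _ _ _ _]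
  simp only [D_sum (e _) hz fun l _ => hS _ _ _ _]
  exact this

end GMLSpace

/-! ### Blocks of the Cartan connection and of its curvature. -/

namespace GMLSpace

variable {p n : ℕ} {Q : GMLSpace p n}

section OffBlock

variable (z : Jet p n) (B : Idx p n)

theorem conn_t_x (γ : Fin p) (i : Fin n) : Q.conn z (Sum.inl γ) (Sum.inr (Sum.inl i)) B = 0 := by
  rcases B with _ | _ | _ <;> rfl

theorem conn_t_v (γ : Fin p) (i : Fin n × Fin p) :
    Q.conn z (Sum.inl γ) (Sum.inr (Sum.inr i)) B = 0 := by
  rcases B with _ | _ | _ <;> rfl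

theorem conn_x_t (k : Fin n) (α : Fin p) : Q.conn z (Sum.inr (Sum.inl k)) (Sum.inl α) B = 0 := by
  rcases B with _ | _ | _ <;> rfl

theorem conn_x_v (k : Fin n) (i : Fin n × Fin p) :
    Q.conn z (Sum.inr (Sum.inl k)) (Sum.inr (Sum.inr i)) B = 0 := by
  rcases B with _ | _ | _ <;> rfl

theorem conn_v_t (k : Fin n × Fin p) (α : Fin p) :
    Q.conn z (Sum.inr (Sum.inr k)) (Sum.inl α) B = 0 := by
  rcases B with _ | _ | _ <;> rfl

theorem conn_v_x (k : Fin n × Fin p) (i : Fin n) :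
    Q.conn z (Sum.inr (Sum.inr k)) (Sum.inr (Sum.inl i)) B = 0 := by
  rcases B with _ | _ | _ <;> rfl

end OffBlock

/-- The connection matrices of the temporal distribution. -/
noncomputable def connT (Q : GMLSpace p n) (A : Idx p n) (z : Jet p n) :
    Matrix (Fin p) (Fin p) ℝ :=
  Matrix.of fun γ α => Q.conn z (Idx.t γ) (Idx.t α) A

/-- The connection matrices of the spatial distribution. -/
noncomputable def connX (Q : GMLSpace p n) (A : Idx p n) (z : Jet p n) :
    Matrix (Fin n) (Fin n) ℝ :=
  Matrix.of fun k i => Q.conn z (Idx.x k) (Idx.x i) A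

/-- The vertical distribution carries the connection of the tensor product of the spatial
distribution with the dual of the temporal one. -/
theorem conn_v_v (z : Jet p n) (k i : Fin n) (γ α : Fin p) (A : Idx p n) :
    Q.conn z (Idx.v k γ) (Idx.v i α) A
      = (if α = γ then Q.connX A z k i else 0) - (if k = i then Q.connT A z α γ else 0) := by
  rcases A with _ | _ | _ <;> simp [conn, connX, connT]

theorem smooth_dg (A : Idx p n) (i j : Fin n) : Q.Smooth fun z => Q.dg z A i j :=
  (smooth_g i j).D A

theorem mSmooth_connT (A : Idx p n) : Q.MSmooth (Q.connT A) := by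
  intro γ α
  rcases A with β | i | i
  exacts [smooth_H γ α β, smooth_const 0, smooth_const 0]

theorem mSmooth_connX (A : Idx p n) : Q.MSmooth (Q.connX A) := by
  intro k i
  rcases A with β | j | ⟨j, γ⟩
  · exact Smooth.const_mul _ (Smooth.sum fun m _ => (smooth_gInv k m).mul (smooth_dg _ _ _))
  · exact Smooth.const_mul _ (Smooth.sum fun m _ => (smooth_gInv k m).mul
      (((smooth_dg _ _ _).add (smooth_dg _ _ _)).sub (smooth_dg _ _ _)))
  · exact Smooth.const_mul _ (Smooth.sum fun m _ => (smooth_gInv k m).mul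
      (((smooth_dg _ _ _).add (smooth_dg _ _ _)).sub (smooth_dg _ _ _)))

theorem smooth_conn (F A B : Idx p n) : Q.Smooth fun z => Q.conn z F A B := by
  rcases F with γ | k | ⟨k, γ⟩ <;> rcases A with α | i | ⟨i, α⟩
  · exact mSmooth_connT B γ α
  · simpa only [conn_t_x] using smooth_const 0
  · simpa only [conn_t_v] using smooth_const 0
  · simpa only [conn_x_t] using smooth_const 0
  · exact mSmooth_connX B k i
  · simpa only [conn_x_v] using smooth_const 0
  · simpa only [conn_v_t] using smooth_const 0
  · simpa only [conn_v_x] using smooth_const 0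
  · simp only [conn_v_v]
    refine Smooth.sub ?_ ?_
    · split_ifs
      exacts [mSmooth_connX B k i, smooth_const 0]
    · split_ifs
      exacts [mSmooth_connT B α γ, smooth_const 0]

theorem smooth_curv (F A B C : Idx p n) : Q.Smooth fun z => Q.curv z F A B C :=
  ((((smooth_conn F A B).D C).sub ((smooth_conn F A C).D B)).add
    (Smooth.sum fun K _ => ((smooth_conn K A B).mul (smooth_conn F K C)).sub
      ((smooth_conn K A C).mul (smooth_conn F K B)))).sub
    (Smooth.sum fun K _ => (smooth_bracket K C B).mul (smooth_conn F A K))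

theorem smooth_Ric (A B : Idx p n) : Q.Smooth fun z => Q.Ric z A B :=
  Smooth.sum fun F _ => smooth_curv F A B F

section CurvatureBlocks

variable (z : Jet p n) (B C : Idx p n)

theorem curv_t_t (γ α : Fin p) :
    Q.curv z (Idx.t γ) (Idx.t α) B C = Q.curvOf Q.connT B C z γ α := by
  simp only [curv, curvOf, DM, connT, bracket, Matrix.sub_apply, Matrix.add_apply,
    Matrix.mul_apply, Matrix.of_apply, Matrix.sum_apply, Matrix.smul_apply, smul_eq_mul,
    Fintype.sum_sum_type, conn_t_x, conn_t_v, zero_mul, Finset.sum_const_zero,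
    add_zero, Finset.sum_sub_distrib, mul_comm]

theorem curv_x_x (k i : Fin n) :
    Q.curv z (Idx.x k) (Idx.x i) B C = Q.curvOf Q.connX B C z k i := by
  simp only [curv, curvOf, DM, connX, bracket, Matrix.sub_apply, Matrix.add_apply,
    Matrix.mul_apply, Matrix.of_apply, Matrix.sum_apply, Matrix.smul_apply, smul_eq_mul,
    Fintype.sum_sum_type, conn_x_t, conn_x_v, zero_mul, Finset.sum_const_zero,
    add_zero, zero_add, Finset.sum_sub_distrib, mul_comm]

/-- A connection preserving the three distributions has curvature preserving them; this gives all
off-diagonal blocks. -/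
theorem curv_eq_zero_of_conn {F A : Idx p n} (h0 : ∀ B w, Q.conn w F A B = 0)
    (hK : ∀ B C K, Q.conn z K A B * Q.conn z F K C = 0) : Q.curv z F A B C = 0 := by
  simp [curv, h0, hK, D_const]

theorem curv_x_t (k : Fin n) (α : Fin p) : Q.curv z (Idx.x k) (Idx.t α) B C = 0 :=
  curv_eq_zero_of_conn z B C (fun B w => conn_x_t w B _ _) fun B C K => by
    rcases K with _ | _ | _ <;> simp [conn_x_t, conn_v_t]

theorem curv_v_t (k : Fin n) (γ α : Fin p) : Q.curv z (Idx.v k γ) (Idx.t α) B C = 0 :=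
  curv_eq_zero_of_conn z B C (fun B w => conn_v_t w B _ _) fun B C K => by
    rcases K with _ | _ | _ <;> simp [conn_v_t, conn_x_t]

theorem curv_t_x (γ : Fin p) (i : Fin n) : Q.curv z (Idx.t γ) (Idx.x i) B C = 0 :=
  curv_eq_zero_of_conn z B C (fun B w => conn_t_x w B _ _) fun B C K => by
    rcases K with _ | _ | _ <;> simp [conn_t_x, conn_v_x, conn_t_v]

theorem curv_v_x (k : Fin n) (γ : Fin p) (i : Fin n) :
    Q.curv z (Idx.v k γ) (Idx.x i) B C = 0 :=
  curv_eq_zero_of_conn z B C (fun B w => conn_v_x w B _ _) fun B C K => by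
    rcases K with _ | _ | _ <;> simp [conn_v_x, conn_t_x]

theorem curv_t_v (γ : Fin p) (i : Fin n) (α : Fin p) :
    Q.curv z (Idx.t γ) (Idx.v i α) B C = 0 :=
  curv_eq_zero_of_conn z B C (fun B w => conn_t_v w B _ _) fun B C K => by
    rcases K with _ | _ | _ <;> simp [conn_t_v, conn_x_v]

theorem curv_x_v (k : Fin n) (i : Fin n) (α : Fin p) :
    Q.curv z (Idx.x k) (Idx.v i α) B C = 0 :=
  curv_eq_zero_of_conn z B C (fun B w => conn_x_v w B _ _) fun B C K => by
    rcases K with _ | _ | _ <;> simp [conn_x_v, conn_t_v]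

theorem curv_v_v {z : Jet p n} (hz : z ∈ Q.E) (k i : Fin n) (γ α : Fin p) :
    Q.curv z (Idx.v k γ) (Idx.v i α) B C
      = (if α = γ then Q.curvOf Q.connX B C z k i else 0)
        - (if k = i then Q.curvOf Q.connT B C z α γ else 0) := by
  have hD : ∀ A B, Q.D A (fun w => Q.conn w (Idx.v k γ) (Idx.v i α) B) z
      = (if α = γ then Q.DM A (Q.connX B) z k i else 0)
        - (if k = i then Q.DM A (Q.connT B) z α γ else 0) := by
    intro A B
    simp only [conn_v_v]
    rw [D_sub A hz]
    · congr 1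
      · split_ifs
        exacts [rfl, D_const A _]
      · split_ifs
        exacts [rfl, D_const A _]
    · split_ifs
      exacts [mSmooth_connX B k i, smooth_const 0]
    · split_ifs
      exacts [mSmooth_connT B α γ, smooth_const 0]
  -- The two cross terms are together symmetric in B and C, so they drop out of the commutator, and
  -- the curvature is that of a tensor product with a dual.
  have hP : ∀ B C, ∑ K, Q.conn z K (Idx.v i α) B * Q.conn z (Idx.v k γ) K C
      = (if α = γ then (Q.connX C z * Q.connX B z) k i else 0)
        - Q.connX B z k i * Q.connT C z α γ - Q.connT B z α γ * Q.connX C z k i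
        + (if k = i then (Q.connT B z * Q.connT C z) α γ else 0) := by
    intro B C
    simp only [Fintype.sum_sum_type, conn_v_t, conn_v_x, mul_zero, Finset.sum_const_zero,
      zero_add, Fintype.sum_prod_type]
    have := fun (a : Fin n) (μ : Fin p) => conn_v_v (Q := Q) z a i μ α B
    have h' := fun (a : Fin n) (μ : Fin p) => conn_v_v (Q := Q) z k a γ μ C
    simp only [Idx.v] at this h'
    simp only [this, h', mul_sub, sub_mul, Finset.sum_sub_distrib, ite_mul, mul_ite, zero_mul,
      mul_zero, Finset.sum_ite_eq', Finset.mem_univ, if_true,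
      Matrix.mul_apply]
    rw [Finset.sum_comm (γ := Fin n)]
    simp only [Finset.sum_ite_eq, Finset.mem_univ, if_true, Finset.sum_sub_distrib, mul_comm]
    split_ifs <;> first | ring1 | (simp only [Finset.sum_const_zero]; ring1)
  rw [curv, hD, hD, Finset.sum_sub_distrib, hP, hP]
  have hS : ∑ K, Q.bracket K C B z * Q.conn z (Idx.v k γ) (Idx.v i α) K
      = (if α = γ then (∑ K, Q.bracket K C B z • Q.connX K z) k i else 0)
        - (if k = i then (∑ K, Q.bracket K C B z • Q.connT K z) α γ else 0) := by
    simp only [conn_v_v, mul_sub, Finset.sum_sub_distrib, Matrix.sum_apply, Matrix.smul_apply,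
      smul_eq_mul]
    split_ifs <;> simp
  simp only [bracket] at hS
  rw [hS]
  simp only [curvOf, Matrix.sub_apply, Matrix.add_apply, bracket]
  split_ifs <;> ring

end CurvatureBlocks

/-! ### Metricity, symmetry and vertical flatness of the block connections. -/

theorem D_comp_fst_eq_zero {f : (Fin p → ℝ) → ℝ} (hf : Q.Smooth fun z => f z.1) {B : Idx p n}
    {z : Jet p n} (hz : z ∈ Q.E) (hB : (Q.frame B z).1 = 0) : Q.D B (fun w => f w.1) z = 0 := by
  rw [D, ← (hf.differentiableAt hz).lineDeriv_eq_fderiv, lineDeriv]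
  simp [hB]

theorem D_comp_fst {f : (Fin p → ℝ) → ℝ} (hf : ContDiffOn ℝ ∞ f Q.U) {z : Jet p n}
    (hz : z ∈ Q.E) (γ : Fin p) :
    Q.D (Idx.t γ) (fun w => f w.1) z = fderiv ℝ f z.1 (Pi.single γ 1) := by
  have hd : DifferentiableAt ℝ f z.1 :=
    (hf.differentiableOn (by simp)).differentiableAt (Q.isOpen_U.mem_nhds hz.1)
  have h : HasFDerivAt (fun w : Jet p n => f w.1) _ z :=
    hd.hasFDerivAt.comp z hasFDerivAt_fst
  rw [D, h.fderiv]
  rfl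

theorem D_h (z : Jet p n) (hz : z ∈ Q.E) (α β γ : Fin p) :
    Q.D (Idx.t γ) (fun w => Q.h w.1 α β) z = Q.dh z.1 α β γ :=
  D_comp_fst (Q.h_smooth α β) hz γ

theorem dh_symm {z : Jet p n} (hz : z ∈ Q.E) (α β γ : Fin p) :
    Q.dh z.1 α β γ = Q.dh z.1 β α γ := by
  rw [← D_h z hz, ← D_h z hz]
  exact D_congr _ hz fun w hw => (Q.h_symm w.1 hw.1).apply _ _

theorem dg_symm {z : Jet p n} (hz : z ∈ Q.E) (A : Idx p n) (i j : Fin n) :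
    Q.dg z A i j = Q.dg z A j i :=
  D_congr _ hz fun w hw => (Q.g_symm w hw.1 hw.2).apply _ _

/-- Lowering an index that has been raised. -/
theorem sum_mul_half_inv {ι : Type*} [Fintype ι] [DecidableEq ι] {G : Matrix ι ι ℝ}
    (hdet : G.det ≠ 0) (v : ι → ℝ) (j : ι) :
    ∑ a, G j a * ((1 / 2) * ∑ m, G⁻¹ a m * v m) = (1 / 2) * v j := by
  have h : G.mulVec (G⁻¹.mulVec v) = v := by
    rw [Matrix.mulVec_mulVec, Matrix.mul_nonsing_inv _ hdet.isUnit, Matrix.one_mulVec]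
  conv_rhs => rw [← h]
  simp only [Matrix.mulVec, dotProduct, Finset.mul_sum]
  exact Finset.sum_congr rfl fun a _ => Finset.sum_congr rfl fun m _ => by ring

theorem isMetric_of_lower {ι : Type*} [Fintype ι] {θ : Idx p n → Jet p n → Matrix ι ι ℝ}
    {G : Jet p n → Matrix ι ι ℝ} (hsymm : ∀ z ∈ Q.E, (G z).IsSymm)
    (h : ∀ z ∈ Q.E, ∀ A i j, Q.D A (fun w => G w i j) z
      = ∑ a, G z j a * θ A z a i + ∑ a, G z i a * θ A z a j) : Q.IsMetric θ G := by
  intro z hz A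
  ext i j
  simp only [DM, Matrix.of_apply, Matrix.add_apply, Matrix.mul_apply, Matrix.transpose_apply]
  rw [h z hz]
  congr 1
  exact Finset.sum_congr rfl fun a _ => by rw [mul_comm, (hsymm z hz).apply a j]

theorem isMetric_connT : Q.IsMetric Q.connT fun z => Q.h z.1 := by
  refine isMetric_of_lower (fun z hz => Q.h_symm z.1 hz.1) fun z hz A α β => ?_
  have hdet := Q.h_nondeg z.1 hz.1
  rcases A with γ | i | i
  · have h1 := sum_mul_half_inv hdet
      (fun μ => Q.dh z.1 μ α γ + Q.dh z.1 μ γ α - Q.dh z.1 α γ μ) β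
    have h2 := sum_mul_half_inv hdet
      (fun μ => Q.dh z.1 μ β γ + Q.dh z.1 μ γ β - Q.dh z.1 β γ μ) α
    change _ = ∑ a, Q.h z.1 β a * Q.H z.1 a α γ + ∑ a, Q.h z.1 α a * Q.H z.1 a β γ
    simp only [H]
    rw [h1, h2, D_h z hz, dh_symm hz β α, dh_symm hz β γ, dh_symm hz α γ]
    ring
  · exact (D_comp_fst_eq_zero (f := fun s => Q.h s α β) (smooth_h α β) hz rfl).trans
      (by simp [connT, conn])
  · exact (D_comp_fst_eq_zero (f := fun s => Q.h s α β) (smooth_h α β) hz rfl).trans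
      (by simp [connT, conn])

/-- Along `δ/δt` each of the two terms contributes half of the derivative of g. Along the other
directions the coefficients have Christoffel form, and the parts skew in i, j cancel. -/
theorem isMetric_connX : Q.IsMetric Q.connX Q.g := by
  refine isMetric_of_lower (fun z hz => Q.g_symm z hz.1 hz.2) fun z hz A i j => ?_
  have hdet := Q.g_nondeg z hz.1 hz.2
  change Q.dg z A i j = _
  rcases A with γ | k | ⟨k, γ⟩
  · have h1 := sum_mul_half_inv hdet (fun m => Q.dg z (Idx.t γ) m i) j
    have h2 := sum_mul_half_inv hdet (fun m => Q.dg z (Idx.t γ) m j) i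
    change _ = ∑ a, Q.g z j a * Q.Gc z a i γ + ∑ a, Q.g z i a * Q.Gc z a j γ
    simp only [Gc]
    rw [h1, h2, dg_symm hz _ j i]
    ring
  · have h1 := sum_mul_half_inv hdet (fun m => Q.dg z (Idx.x k) m i + Q.dg z (Idx.x i) m k
      - Q.dg z (Idx.x m) i k) j
    have h2 := sum_mul_half_inv hdet (fun m => Q.dg z (Idx.x k) m j + Q.dg z (Idx.x j) m k
      - Q.dg z (Idx.x m) j k) i
    change _ = ∑ a, Q.g z j a * Q.L z a i k + ∑ a, Q.g z i a * Q.L z a j k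
    simp only [L]
    rw [h1, h2, dg_symm hz _ j i]
    ring
  · have h1 := sum_mul_half_inv hdet (fun m => Q.dg z (Idx.v k γ) m i + Q.dg z (Idx.v i γ) m k
      - Q.dg z (Idx.v m γ) i k) j
    have h2 := sum_mul_half_inv hdet (fun m => Q.dg z (Idx.v k γ) m j + Q.dg z (Idx.v j γ) m k
      - Q.dg z (Idx.v m γ) j k) i
    change _ = ∑ a, Q.g z j a * Q.C z a i k γ + ∑ a, Q.g z i a * Q.C z a j k γ
    simp only [C]
    rw [h1, h2, dg_symm hz _ j i]
    ring

theorem connT_symm {z : Jet p n} (hz : z ∈ Q.E) (γ α β : Fin p) :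
    Q.connT (Idx.t β) z γ α = Q.connT (Idx.t α) z γ β := by
  change Q.H z.1 γ α β = Q.H z.1 γ β α
  unfold H
  congr 1
  exact Finset.sum_congr rfl fun μ _ => by rw [dh_symm hz α β μ]; ring

theorem connX_symm {z : Jet p n} (hz : z ∈ Q.E) (k i j : Fin n) :
    Q.connX (Idx.x j) z k i = Q.connX (Idx.x i) z k j := by
  change Q.L z k i j = Q.L z k j i
  unfold L
  congr 1
  exact Finset.sum_congr rfl fun μ _ => by rw [dg_symm hz _ i j]; ring

theorem connT_eq_zero_or (A : Idx p n) :
    (∃ β, A = Idx.t β) ∨ Q.connT A = fun _ => 0 := by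
  rcases A with β | i | i
  exacts [Or.inl ⟨β, rfl⟩, Or.inr rfl, Or.inr rfl]

/-- The temporal connection depends on t alone and has coefficients only along `δ/δt`, while
brackets are vertical, so every term of the curvature vanishes. -/
theorem curvOf_connT_eq_zero {z : Jet p n} (hz : z ∈ Q.E) {B : Idx p n} (C : Idx p n)
    (hB : ∀ w, (Q.frame B w).1 = 0) (hB' : Q.connT B = fun _ => 0) :
    Q.curvOf Q.connT B C z = 0 := by
  have h1 : Q.DM B (Q.connT C) z = 0 := by
    rcases C with β | i | i
    · ext γ α
      exact D_comp_fst_eq_zero (f := fun s => Q.H s γ α β) (smooth_H γ α β) hz (hB z)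
    · exact DM_const _ 0
    · exact DM_const _ 0
  have h2 : ∑ K, Q.bracket K C B z • Q.connT K z = 0 := by
    refine Finset.sum_eq_zero fun K _ => ?_
    rcases connT_eq_zero_or (Q := Q) K with ⟨β, rfl⟩ | hK
    · rw [bracket_t β C B hz, zero_smul]
    · rw [hK, smul_zero]
  rw [curvOf, h1, h2, hB', DM_const]
  simp

theorem curvOf_connT_x {z : Jet p n} (hz : z ∈ Q.E) (i : Fin n) (C : Idx p n) :
    Q.curvOf Q.connT (Idx.x i) C z = 0 :=
  curvOf_connT_eq_zero hz C (fun _ => rfl) rfl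

theorem curvOf_connT_v {z : Jet p n} (hz : z ∈ Q.E) (i : Fin n) (α : Fin p) (C : Idx p n) :
    Q.curvOf Q.connT (Idx.v i α) C z = 0 :=
  curvOf_connT_eq_zero hz C (fun _ => rfl) rfl

/-- Brackets are vertical, so only vertical values of W contribute. This discharges the torsion
hypothesis of `IsMetric.contracted_bianchi`. -/
theorem sum_bracket_smul {z : Jet p n} (hz : z ∈ Q.E) {M : Type*} [AddCommGroup M] [Module ℝ M]
    (W : Idx p n → M) (hW : ∀ i α, W (Idx.v i α) = 0) (B C : Idx p n) :
    ∑ K, Q.bracket K C B z • W K = 0 := by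
  refine Finset.sum_eq_zero fun K _ => ?_
  rcases K with α | i | ⟨i, α⟩
  · exact (congrArg (· • _) (bracket_t α C B hz)).trans (zero_smul _ _)
  · exact (congrArg (· • _) (bracket_x i C B hz)).trans (zero_smul _ _)
  · exact (congrArg (_ • ·) (hW i α)).trans (smul_zero _)

/-! ### The Ricci d-tensor and its partial divergences. -/

section Ricci

variable (z : Jet p n) (B : Idx p n)

theorem Ric_t (α : Fin p) :
    Q.Ric z (Idx.t α) B = ∑ γ, Q.curvOf Q.connT B (Idx.t γ) z γ α := by
  simp only [Ric, Fintype.sum_sum_type, Fintype.sum_prod_type, curv_x_t, curv_v_t, curv_t_t,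
    Finset.sum_const_zero, add_zero]

theorem Ric_x (i : Fin n) :
    Q.Ric z (Idx.x i) B = ∑ k, Q.curvOf Q.connX B (Idx.x k) z k i := by
  simp only [Ric, Fintype.sum_sum_type, Fintype.sum_prod_type, curv_t_x, curv_v_x, curv_x_x,
    Finset.sum_const_zero, add_zero, zero_add]

theorem Ric_v {z : Jet p n} (hz : z ∈ Q.E) (i : Fin n) (α : Fin p) :
    Q.Ric z (Idx.v i α) B = ∑ k, Q.curvOf Q.connX B (Idx.v k α) z k i := by
  have h : ∀ γ, Q.curvOf Q.connT B (Idx.v i γ) z = 0 := fun γ => by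
    rw [curvOf_swap, curvOf_connT_v hz, neg_zero]
  simp only [Ric, Fintype.sum_sum_type, Fintype.sum_prod_type, curv_t_v, curv_x_v,
    curv_v_v _ _ hz, Finset.sum_const_zero, zero_add, Finset.sum_sub_distrib,
    Finset.sum_ite_eq, Finset.mem_univ, if_true]
  -- The contraction pairs B with a vertical leg, on which the temporal curvature vanishes; only the
  -- spatial curvature remains.
  rw [sub_eq_self]
  refine Finset.sum_eq_zero fun k _ => Finset.sum_eq_zero fun γ _ => ?_
  split_ifs with hk
  · rw [hk, h]; rfl
  · rfl

theorem Ric_t_x {z : Jet p n} (hz : z ∈ Q.E) (α : Fin p) (i : Fin n) :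
    Q.Ric z (Idx.t α) (Idx.x i) = 0 := by
  simp [Ric_t, curvOf_connT_x hz]

theorem Ric_t_v {z : Jet p n} (hz : z ∈ Q.E) (α : Fin p) (i : Fin n) (β : Fin p) :
    Q.Ric z (Idx.t α) (Idx.v i β) = 0 := by
  simp [Ric_t, curvOf_connT_v hz]

end Ricci

section Raise

variable (W : Jet p n → Idx p n → Idx p n → ℝ) (z : Jet p n) (A : Idx p n)

theorem raise_t (μ : Fin p) :
    Q.raise W z (Idx.t μ) A = ∑ α, (Q.h z.1)⁻¹ μ α * W z (Idx.t α) A := by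
  simp [raise, Fintype.sum_sum_type, invMetric]

theorem raise_x (m : Fin n) :
    Q.raise W z (Idx.x m) A = ∑ i, (Q.g z)⁻¹ m i * W z (Idx.x i) A := by
  simp [raise, Fintype.sum_sum_type, invMetric]

theorem raise_v (m : Fin n) (μ : Fin p) :
    Q.raise W z (Idx.v m μ) A
      = ∑ i, ∑ α, Q.h z.1 μ α * (Q.g z)⁻¹ m i * W z (Idx.v i α) A := by
  simp [raise, Fintype.sum_sum_type, Fintype.sum_prod_type, invMetric]

end Raise

/-- Puts the mixed Ricci block in the form appearing in `IsMetric.contracted_bianchi`. -/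
theorem raise_Ric_t {z : Jet p n} (hz : z ∈ Q.E) (m k : Fin p) :
    Q.raise Q.Ric z (Idx.t m) (Idx.t k)
      = ∑ l, Q.raisedCurv Q.connT (fun w => Q.h w.1) (Idx.t k) (Idx.t l) z l m := by
  rw [raise_t]
  simp only [Ric_t, raisedCurv, Matrix.mul_apply, Finset.mul_sum]
  rw [Finset.sum_comm]
  refine Finset.sum_congr rfl fun l _ => Finset.sum_congr rfl fun i _ => ?_
  rw [mul_comm, (Q.h_symm z.1 hz.1).inv.apply i m]

theorem raise_Ric_x {z : Jet p n} (hz : z ∈ Q.E) (m k : Fin n) :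
    Q.raise Q.Ric z (Idx.x m) (Idx.x k)
      = ∑ l, Q.raisedCurv Q.connX Q.g (Idx.x k) (Idx.x l) z l m := by
  rw [raise_x]
  simp only [Ric_x, raisedCurv, Matrix.mul_apply, Finset.mul_sum]
  rw [Finset.sum_comm]
  refine Finset.sum_congr rfl fun l _ => Finset.sum_congr rfl fun i _ => ?_
  rw [mul_comm, (Q.g_symm z hz.1 hz.2).inv.apply i m]

theorem trT_Ric (z : Jet p n) :
    Q.trT Q.Ric z
      = ∑ j, ∑ l, Q.raisedCurv Q.connT (fun w => Q.h w.1) (Idx.t j) (Idx.t l) z l j := by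
  simp only [trT, Ric_t, raisedCurv, Matrix.mul_apply, Finset.mul_sum]
  rw [Finset.sum_comm]
  refine Finset.sum_congr rfl fun j _ => ?_
  rw [Finset.sum_comm]
  exact Finset.sum_congr rfl fun l _ => Finset.sum_congr rfl fun i _ => mul_comm _ _

theorem trM_Ric (z : Jet p n) :
    Q.trM Q.Ric z = ∑ j, ∑ l, Q.raisedCurv Q.connX Q.g (Idx.x j) (Idx.x l) z l j := by
  simp only [trM, Ric_x, raisedCurv, Matrix.mul_apply, Finset.mul_sum]
  rw [Finset.sum_comm]
  refine Finset.sum_congr rfl fun j _ => ?_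
  rw [Finset.sum_comm]
  exact Finset.sum_congr rfl fun l _ => Finset.sum_congr rfl fun i _ => mul_comm _ _

/-- The contracted Bianchi identity of the temporal metric. -/
theorem divT_Ric {z : Jet p n} (hz : z ∈ Q.E) (k : Fin p) :
    Q.divT Q.Ric z (Idx.t k) = (1 / 2) * Q.D (Idx.t k) (Q.trT Q.Ric) z := by
  rw [D_congr _ hz fun w _ => trT_Ric w, ← isMetric_connT.contracted_bianchi mSmooth_connT
    (fun i j => smooth_h i j) (fun z hz => Q.h_symm z.1 hz.1) (fun z hz => Q.h_nondeg z.1 hz.1)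
    Idx.t hz (fun a b c => connT_symm hz a b c)
    (fun q k m => sum_bracket_smul hz _ (fun i α => curvOf_connT_v hz i α _) _ _) k, divT]
  refine Finset.sum_congr rfl fun m _ => ?_
  rw [cov, D_congr _ hz fun w hw => raise_Ric_t hw m k]
  simp only [Fintype.sum_sum_type, conn_t_x, conn_t_v, conn_x_t, conn_v_t, zero_mul,
    Finset.sum_const_zero, add_zero, raise_Ric_t hz]
  rfl

/-- The contracted Bianchi identity of the spatial metric, when the curvature `P` vanishes. -/
theorem divM_Ric (hP : ∀ z ∈ Q.E, ∀ l q i m μ, Q.curvP z l q i m μ = 0) {z : Jet p n}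
    (hz : z ∈ Q.E) (k : Fin n) :
    Q.divM Q.Ric z (Idx.x k) = (1 / 2) * Q.D (Idx.x k) (Q.trM Q.Ric) z := by
  -- The vertical bracket of two spatial frame fields enters the Bianchi identity multiplied by this
  -- curvature, which is P up to sign.
  have hv : ∀ i α m, Q.curvOf Q.connX (Idx.v i α) (Idx.x m) z = 0 := by
    intro i α m
    rw [curvOf_swap, neg_eq_zero]
    ext l q
    rw [← curv_x_x]
    exact hP z hz l q m i α
  rw [D_congr _ hz fun w _ => trM_Ric w, ← isMetric_connX.contracted_bianchi mSmooth_connX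
    (fun i j => smooth_g i j) (fun z hz => Q.g_symm z hz.1 hz.2)
    (fun z hz => Q.g_nondeg z hz.1 hz.2) Idx.x hz (fun a b c => connX_symm hz a b c)
    (fun q k m => sum_bracket_smul hz _ (fun i α => hv i α m) _ _) k, divM]
  refine Finset.sum_congr rfl fun m _ => ?_
  rw [cov, D_congr _ hz fun w hw => raise_Ric_x hw m k]
  simp only [Fintype.sum_sum_type, conn_t_x, conn_x_v, conn_x_t, conn_v_x, zero_mul,
    Finset.sum_const_zero, add_zero, zero_add, raise_Ric_x hz]
  rfl

end GMLSpace

/-! ### Subtracting multiples of the metric blocks from the Ricci d-tensor. -/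

namespace GMLSpace

variable {p n : ℕ} {Q : GMLSpace p n}

/-- Scalars that are constant on each block commute with the connection matrices, because these are
block diagonal. -/
theorem conn_mul_sub {φ : Idx p n → ℝ} {a b c : ℝ} (ht : ∀ α, φ (Idx.t α) = a)
    (hx : ∀ i, φ (Idx.x i) = b) (hv : ∀ i α, φ (Idx.v i α) = c) (z : Jet p n)
    (A B C : Idx p n) : Q.conn z B A C * (φ A - φ B) = 0 := by
  rcases A with α | i | ⟨i, α⟩ <;> rcases B with β | j | ⟨j, β⟩ <;>
    simp_all [conn_t_x, conn_t_v, conn_x_t, conn_x_v, conn_v_t, conn_v_x]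

/-- A function of the adapted index and the point, constant on each of the three blocks. -/
def blockFun (a b c : Jet p n → ℝ) (A : Idx p n) : Jet p n → ℝ :=
  match A with
  | Sum.inl _ => a
  | Sum.inr (Sum.inl _) => b
  | Sum.inr (Sum.inr _) => c

theorem inv_mul_apply {ι : Type*} [Fintype ι] [DecidableEq ι] {G : Matrix ι ι ℝ}
    (hdet : G.det ≠ 0) (i j : ι) : ∑ k, G⁻¹ i k * G k j = if i = j then 1 else 0 := by
  rw [← Matrix.mul_apply, Matrix.nonsing_inv_mul _ hdet.isUnit, Matrix.one_apply]

theorem mul_inv_apply {ι : Type*} [Fintype ι] [DecidableEq ι] {G : Matrix ι ι ℝ}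
    (hdet : G.det ≠ 0) (i j : ι) : ∑ k, G i k * G⁻¹ k j = if i = j then 1 else 0 := by
  rw [← Matrix.mul_apply, Matrix.mul_nonsing_inv _ hdet.isUnit, Matrix.one_apply]

theorem raise_metric {z : Jet p n} (hz : z ∈ Q.E) (B A : Idx p n) :
    Q.raise Q.metric z B A = if B = A then 1 else 0 := by
  have hh := Q.h_nondeg z.1 hz.1
  have hg := Q.g_nondeg z hz.1 hz.2
  rcases B with μ | m | ⟨m, μ⟩
  · rw [raise_t]
    rcases A with α | i | ⟨i, α⟩ <;> simp [metric, inv_mul_apply hh]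
  · rw [raise_x]
    rcases A with α | i | ⟨i, α⟩ <;> simp [metric, inv_mul_apply hg]
  · rw [raise_v]
    rcases A with α | i | ⟨i, α⟩
    · simp [metric]
    · simp [metric]
    · simp only [metric]
      have : ∀ x y, Q.h z.1 μ y * (Q.g z)⁻¹ m x * ((Q.h z.1)⁻¹ y α * Q.g z x i)
          = ((Q.g z)⁻¹ m x * Q.g z x i) * (Q.h z.1 μ y * (Q.h z.1)⁻¹ y α) := fun x y => by ring
      simp only [this, ← Finset.mul_sum, ← Finset.sum_mul, inv_mul_apply hg, mul_inv_apply hh]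
      by_cases h1 : m = i <;> by_cases h2 : μ = α <;> simp [h1, h2]

theorem smooth_invMetric (A B : Idx p n) : Q.Smooth fun z => Q.invMetric z A B := by
  rcases A with α | i | ⟨i, α⟩ <;> rcases B with β | j | ⟨j, β⟩
  exacts [smooth_hInv _ _, smooth_const 0, smooth_const 0, smooth_const 0, smooth_gInv _ _,
    smooth_const 0, smooth_const 0, smooth_const 0, (smooth_h _ _).mul (smooth_gInv _ _)]

theorem smooth_raise_Ric (B A : Idx p n) : Q.Smooth fun z => Q.raise Q.Ric z B A :=
  Smooth.sum fun F _ => (smooth_invMetric B F).mul (smooth_Ric F A)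

theorem smooth_trT_Ric : Q.Smooth (Q.trT Q.Ric) :=
  Smooth.sum fun α _ => Smooth.sum fun β _ => (smooth_hInv α β).mul (smooth_Ric _ _)

theorem smooth_trM_Ric : Q.Smooth (Q.trM Q.Ric) :=
  Smooth.sum fun α _ => Smooth.sum fun β _ => (smooth_gInv α β).mul (smooth_Ric _ _)

theorem smooth_trV_Ric : Q.Smooth (Q.trV Q.Ric) :=
  Smooth.sum fun i _ => Smooth.sum fun α _ => Smooth.sum fun j _ => Smooth.sum fun β _ =>
    ((smooth_h α β).mul (smooth_gInv i j)).mul (smooth_Ric _ _)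

theorem Sc_eq (z : Jet p n) : Q.Sc z = Q.trT Q.Ric z + Q.trM Q.Ric z + Q.trV Q.Ric z := by
  simp [Sc, Fintype.sum_sum_type, Fintype.sum_prod_type, invMetric, trT, trM, trV, add_assoc]

section Shifted

variable {𝒦 : ℝ} {W : Jet p n → Idx p n → Idx p n → ℝ} {a b c : Jet p n → ℝ} {z : Jet p n}

theorem raise_shifted (hz : z ∈ Q.E) (φ : Idx p n → Jet p n → ℝ)
    (hW : ∀ w ∈ Q.E, ∀ F A, 𝒦 * W w F A = Q.Ric w F A - φ A w * Q.metric w F A)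
    (B A : Idx p n) :
    𝒦 * Q.raise W z B A = Q.raise Q.Ric z B A - φ A z * if B = A then 1 else 0 := by
  rw [← raise_metric hz, raise, raise, raise, Finset.mul_sum, Finset.mul_sum,
    ← Finset.sum_sub_distrib]
  refine Finset.sum_congr rfl fun F _ => ?_
  linear_combination Q.invMetric z B F * hW z hz F A

/-- Subtracting from the Ricci d-tensor multiples of the blocks of the metric changes covariant
derivatives of mixed components by derivatives of the factors. -/
theorem cov_shifted (h𝒦 : 𝒦 ≠ 0) (hz : z ∈ Q.E) (ha : Q.Smooth a) (hb : Q.Smooth b)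
    (hc : Q.Smooth c)
    (hW : ∀ w ∈ Q.E, ∀ F A, 𝒦 * W w F A = Q.Ric w F A - blockFun a b c A w * Q.metric w F A)
    (C B A : Idx p n) :
    𝒦 * Q.cov (Q.raise W) z C B A
      = Q.cov (Q.raise Q.Ric) z C B A - if B = A then Q.D C (blockFun a b c A) z else 0 := by
  have hr := fun w hw => raise_shifted (z := w) hw (blockFun a b c) hW
  have hφ : Q.Smooth (blockFun a b c A) := by
    rcases A with _ | _ | _
    exacts [ha, hb, hc]
  have hδ : Q.Smooth fun w => blockFun a b c A w * if B = A then 1 else 0 :=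
    hφ.mul (smooth_const _)
  -- `W` is not assumed smooth; its regularity comes from that of the Ricci d-tensor after division
  -- by 𝒦.
  have hrW : Q.Smooth fun w => Q.raise W w B A := by
    refine (((smooth_raise_Ric B A).sub hδ).const_mul 𝒦⁻¹).congr fun w hw => ?_
    rw [← hr w hw, inv_mul_cancel_left₀ h𝒦]
  have hD : 𝒦 * Q.D C (fun w => Q.raise W w B A) z
      = Q.D C (fun w => Q.raise Q.Ric w B A) z
        - if B = A then Q.D C (blockFun a b c A) z else 0 := by
    rw [← D_const_mul C hz 𝒦 hrW, D_congr C hz fun w hw => hr w hw B A,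
      D_sub C hz (smooth_raise_Ric B A) hδ, D_mul C hz hφ (smooth_const _), D_const]
    split_ifs <;> ring
  have hconn := conn_mul_sub (Q := Q) (φ := fun A => blockFun a b c A z) (fun _ => rfl)
    (fun _ => rfl) (fun _ _ => rfl) z A B C
  have h1 : 𝒦 * ∑ F, Q.conn z B F C * Q.raise W z F A
      = (∑ F, Q.conn z B F C * Q.raise Q.Ric z F A) - blockFun a b c A z * Q.conn z B A C := by
    have : ∀ F, 𝒦 * (Q.conn z B F C * Q.raise W z F A) = Q.conn z B F C * Q.raise Q.Ric z F A
        - if F = A then blockFun a b c A z * Q.conn z B F C else 0 := by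
      intro F
      rw [mul_left_comm, hr z hz]
      split_ifs <;> ring
    simp only [Finset.mul_sum, this, Finset.sum_sub_distrib, Finset.sum_ite_eq', Finset.mem_univ,
      if_true]
  have h2 : 𝒦 * ∑ F, Q.conn z F A C * Q.raise W z B F
      = (∑ F, Q.conn z F A C * Q.raise Q.Ric z B F) - blockFun a b c B z * Q.conn z B A C := by
    have : ∀ F, 𝒦 * (Q.conn z F A C * Q.raise W z B F) = Q.conn z F A C * Q.raise Q.Ric z B F
        - if B = F then blockFun a b c F z * Q.conn z F A C else 0 := by
      intro F
      rw [mul_left_comm, hr z hz]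
      split_ifs <;> ring
    simp only [Finset.mul_sum, this, Finset.sum_sub_distrib, Finset.sum_ite_eq, Finset.mem_univ,
      if_true]
  rw [cov, cov, mul_sub, mul_add, hD, h1, h2]
  -- The two connection terms carry the factors of block A and of block B; they agree wherever the
  -- connection coefficient is nonzero.
  linear_combination -hconn

theorem divT_shifted (h𝒦 : 𝒦 ≠ 0) (hz : z ∈ Q.E) (ha : Q.Smooth a) (hb : Q.Smooth b)
    (hc : Q.Smooth c)
    (hW : ∀ w ∈ Q.E, ∀ F A, 𝒦 * W w F A = Q.Ric w F A - blockFun a b c A w * Q.metric w F A)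
    (A : Idx p n) :
    𝒦 * Q.divT W z A = Q.divT Q.Ric z A - ∑ μ, if Idx.t μ = A then Q.D A a z else 0 := by
  rw [divT, divT, Finset.mul_sum, ← Finset.sum_sub_distrib]
  refine Finset.sum_congr rfl fun μ _ => ?_
  rw [cov_shifted h𝒦 hz ha hb hc hW]
  split_ifs with h
  · subst h; rfl
  · rfl

theorem divM_shifted (h𝒦 : 𝒦 ≠ 0) (hz : z ∈ Q.E) (ha : Q.Smooth a) (hb : Q.Smooth b)
    (hc : Q.Smooth c)
    (hW : ∀ w ∈ Q.E, ∀ F A, 𝒦 * W w F A = Q.Ric w F A - blockFun a b c A w * Q.metric w F A)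
    (A : Idx p n) :
    𝒦 * Q.divM W z A = Q.divM Q.Ric z A - ∑ m, if Idx.x m = A then Q.D A b z else 0 := by
  rw [divM, divM, Finset.mul_sum, ← Finset.sum_sub_distrib]
  refine Finset.sum_congr rfl fun μ _ => ?_
  rw [cov_shifted h𝒦 hz ha hb hc hW]
  split_ifs with h
  · subst h; rfl
  · rfl

theorem divV_shifted (h𝒦 : 𝒦 ≠ 0) (hz : z ∈ Q.E) (ha : Q.Smooth a) (hb : Q.Smooth b)
    (hc : Q.Smooth c)
    (hW : ∀ w ∈ Q.E, ∀ F A, 𝒦 * W w F A = Q.Ric w F A - blockFun a b c A w * Q.metric w F A)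
    (A : Idx p n) :
    𝒦 * Q.divV W z A
      = Q.divV Q.Ric z A - ∑ m, ∑ μ, if Idx.v m μ = A then Q.D A c z else 0 := by
  simp only [divV, Finset.mul_sum, ← Finset.sum_sub_distrib]
  refine Finset.sum_congr rfl fun m _ => Finset.sum_congr rfl fun μ _ => ?_
  rw [cov_shifted h𝒦 hz ha hb hc hW]
  split_ifs with h
  · subst h; rfl
  · rfl

theorem sum_mul_inv_symm {ι : Type*} [Fintype ι] [DecidableEq ι] {G : Matrix ι ι ℝ}
    (hsymm : G.IsSymm) (hdet : G.det ≠ 0) :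
    ∑ i, ∑ j, G⁻¹ i j * G i j = Fintype.card ι := by
  have h : ∀ i, ∑ j, G⁻¹ i j * G i j = 1 := fun i => by
    simp only [← hsymm.apply i, inv_mul_apply hdet, if_true]
  simp [h]

theorem trT_metric (hz : z ∈ Q.E) : Q.trT Q.metric z = p := by
  simpa [trT, metric] using sum_mul_inv_symm (Q.h_symm z.1 hz.1) (Q.h_nondeg z.1 hz.1)

theorem trM_metric (hz : z ∈ Q.E) : Q.trM Q.metric z = n := by
  simpa [trM, metric] using sum_mul_inv_symm (Q.g_symm z hz.1 hz.2) (Q.g_nondeg z hz.1 hz.2)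

theorem trV_metric (hz : z ∈ Q.E) : Q.trV Q.metric z = (p : ℝ) * n := by
  have h1 := trT_metric hz
  have h2 := trM_metric hz
  rw [← h1, ← h2]
  simp only [trT, trM, trV, metric, Finset.sum_mul_sum]
  rw [Finset.sum_comm]
  refine Finset.sum_congr rfl fun α _ => Finset.sum_congr rfl fun i _ => ?_
  rw [Finset.sum_comm]
  exact Finset.sum_congr rfl fun β _ => Finset.sum_congr rfl fun j _ => by ring

/-- With a equal to half the Ricci trace, the right side is (2 - p)/2 times that trace; the
analogues give 2 - n and 2 - pn. -/
theorem trT_shifted (hz : z ∈ Q.E)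
    (hW : ∀ w ∈ Q.E, ∀ F A, 𝒦 * W w F A = Q.Ric w F A - blockFun a b c A w * Q.metric w F A) :
    𝒦 * Q.trT W z = Q.trT Q.Ric z - a z * p := by
  rw [← trT_metric hz]
  simp only [trT, Finset.mul_sum, ← Finset.sum_sub_distrib]
  refine Finset.sum_congr rfl fun α _ => Finset.sum_congr rfl fun β _ => ?_
  have := hW z hz (Idx.t α) (Idx.t β)
  simp only [blockFun] at this
  linear_combination (Q.h z.1)⁻¹ α β * this

theorem trM_shifted (hz : z ∈ Q.E)
    (hW : ∀ w ∈ Q.E, ∀ F A, 𝒦 * W w F A = Q.Ric w F A - blockFun a b c A w * Q.metric w F A) :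
    𝒦 * Q.trM W z = Q.trM Q.Ric z - b z * n := by
  rw [← trM_metric hz]
  simp only [trM, Finset.mul_sum, ← Finset.sum_sub_distrib]
  refine Finset.sum_congr rfl fun i _ => Finset.sum_congr rfl fun j _ => ?_
  have := hW z hz (Idx.x i) (Idx.x j)
  simp only [blockFun] at this
  linear_combination (Q.g z)⁻¹ i j * this

theorem trV_shifted (hz : z ∈ Q.E)
    (hW : ∀ w ∈ Q.E, ∀ F A, 𝒦 * W w F A = Q.Ric w F A - blockFun a b c A w * Q.metric w F A) :
    𝒦 * Q.trV W z = Q.trV Q.Ric z - c z * (p * n) := by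
  rw [← trV_metric hz]
  simp only [trV, Finset.mul_sum, ← Finset.sum_sub_distrib]
  refine Finset.sum_congr rfl fun i _ => Finset.sum_congr rfl fun α _ =>
    Finset.sum_congr rfl fun j _ => Finset.sum_congr rfl fun β _ => ?_
  have := hW z hz (Idx.v i α) (Idx.v j β)
  simp only [blockFun] at this
  linear_combination Q.h z.1 α β * (Q.g z)⁻¹ i j * this

end Shifted

/-! ### The two stress-energy d-tensors as shifted Ricci d-tensors. -/

section Einstein

variable {𝒦 : ℝ} {𝒯 : Jet p n → Idx p n → Idx p n → ℝ}

theorem Einstein.shifted (hE : Q.Einstein 𝒦 𝒯) : ∀ w ∈ Q.E, ∀ F A, 𝒦 * 𝒯 w F A = Q.Ric w F A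
    - blockFun (fun w => 1 / 2 * Q.Sc w) (fun w => 1 / 2 * Q.Sc w) (fun w => 1 / 2 * Q.Sc w) A w
      * Q.metric w F A := by
  intro w hw F A
  rw [← hE w hw]
  rcases A with _ | _ | _ <;> simp only [blockFun] <;> ring

/-- The added term cancels, in each diagonal block, the part of `Sc`/2 that comes from the other two
traces. Off the diagonal blocks the metric vanishes and nothing changes. -/
theorem Einstein.newT_shifted (hE : Q.Einstein 𝒦 𝒯) (h𝒦 : 𝒦 ≠ 0) : ∀ w ∈ Q.E, ∀ F A,
    𝒦 * Q.newT 𝒦 𝒯 w F A = Q.Ric w F A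
      - blockFun (fun w => 1 / 2 * Q.trT Q.Ric w) (fun w => 1 / 2 * Q.trM Q.Ric w)
        (fun w => 1 / 2 * Q.trV Q.Ric w) A w * Q.metric w F A := by
  intro w hw F A
  have h := hE w hw F A
  rw [Sc_eq] at h
  rcases F with β | j | ⟨j, β⟩ <;> rcases A with α | i | ⟨i, α⟩ <;>
    simp only [blockFun, newT, metric, mul_zero, sub_zero] at h ⊢ <;>
    first
    | exact h.symm
    | (rw [mul_add, ← h]; field_simp; ring)

end Einstein

/-! ### Vanishing partial divergences and the main theorem. -/

theorem cov_eq_zero {W : Jet p n → Idx p n → Idx p n → ℝ} {z : Jet p n} (hz : z ∈ Q.E)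
    {C B A : Idx p n} (h0 : ∀ w ∈ Q.E, W w B A = 0)
    (h1 : ∀ F, Q.conn z B F C * W z F A = 0) (h2 : ∀ F, Q.conn z F A C * W z B F = 0) :
    Q.cov W z C B A = 0 := by
  rw [cov, D_congr C hz h0, D_const]
  simp [h1, h2]

theorem raise_Ric_t_x {z : Jet p n} (hz : z ∈ Q.E) (μ : Fin p) (i : Fin n) :
    Q.raise Q.Ric z (Idx.t μ) (Idx.x i) = 0 := by
  simp [raise_t, Ric_t_x hz]

theorem raise_Ric_t_v {z : Jet p n} (hz : z ∈ Q.E) (μ : Fin p) (i : Fin n) (α : Fin p) :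
    Q.raise Q.Ric z (Idx.t μ) (Idx.v i α) = 0 := by
  simp [raise_t, Ric_t_v hz]

theorem divT_Ric_x {z : Jet p n} (hz : z ∈ Q.E) (i : Fin n) : Q.divT Q.Ric z (Idx.x i) = 0 := by
  refine Finset.sum_eq_zero fun μ _ => cov_eq_zero hz (fun w hw => raise_Ric_t_x hw μ i) ?_ ?_
  · rintro (β | j | ⟨j, β⟩)
    · rw [raise_Ric_t_x hz, mul_zero]
    · rw [conn_t_x, zero_mul]
    · rw [conn_t_v, zero_mul]
  · rintro (β | j | ⟨j, β⟩)
    · rw [conn_t_x, zero_mul]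
    · rw [raise_Ric_t_x hz, mul_zero]
    · rw [conn_v_x, zero_mul]

theorem divT_Ric_v {z : Jet p n} (hz : z ∈ Q.E) (i : Fin n) (α : Fin p) :
    Q.divT Q.Ric z (Idx.v i α) = 0 := by
  refine Finset.sum_eq_zero fun μ _ => cov_eq_zero hz (fun w hw => raise_Ric_t_v hw μ i α) ?_ ?_
  · rintro (β | j | ⟨j, β⟩)
    · rw [raise_Ric_t_v hz, mul_zero]
    · rw [conn_t_x, zero_mul]
    · rw [conn_t_v, zero_mul]
  · rintro (β | j | ⟨j, β⟩)
    · rw [conn_t_v, zero_mul]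
    · rw [conn_x_v, zero_mul]
    · rw [raise_Ric_t_v hz, mul_zero]

section VerticalFlat

theorem Ric_v_v (hS : ∀ z ∈ Q.E, ∀ l q i m α μ, Q.curvS z l q i m α μ = 0) {z : Jet p n}
    (hz : z ∈ Q.E) (i : Fin n) (α : Fin p) (j : Fin n) (β : Fin p) :
    Q.Ric z (Idx.v i α) (Idx.v j β) = 0 := by
  rw [Ric_v _ hz]
  refine Finset.sum_eq_zero fun k _ => ?_
  rw [← curv_x_x]
  exact hS z hz k i j k β α

theorem raise_Ric_v_v (hS : ∀ z ∈ Q.E, ∀ l q i m α μ, Q.curvS z l q i m α μ = 0) {z : Jet p n}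
    (hz : z ∈ Q.E) (i : Fin n) (α : Fin p) (j : Fin n) (β : Fin p) :
    Q.raise Q.Ric z (Idx.v i α) (Idx.v j β) = 0 := by
  simp [raise_v, Ric_v_v hS hz]

theorem trV_Ric_eq_zero (hS : ∀ z ∈ Q.E, ∀ l q i m α μ, Q.curvS z l q i m α μ = 0) {z : Jet p n}
    (hz : z ∈ Q.E) : Q.trV Q.Ric z = 0 := by
  simp [trV, Ric_v_v hS hz]

theorem divV_Ric (hS : ∀ z ∈ Q.E, ∀ l q i m α μ, Q.curvS z l q i m α μ = 0) {z : Jet p n}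
    (hz : z ∈ Q.E) (i : Fin n) (α : Fin p) : Q.divV Q.Ric z (Idx.v i α) = 0 := by
  refine Finset.sum_eq_zero fun m _ => Finset.sum_eq_zero fun μ _ =>
    cov_eq_zero hz (fun w hw => raise_Ric_v_v hS hw m μ i α) ?_ ?_
  · rintro (β | j | ⟨j, β⟩)
    · rw [conn_v_t, zero_mul]
    · rw [conn_v_x, zero_mul]
    · rw [raise_Ric_v_v hS hz, mul_zero]
  · rintro (β | j | ⟨j, β⟩)
    · rw [conn_t_v, zero_mul]
    · rw [conn_x_v, zero_mul]
    · rw [raise_Ric_v_v hS hz, mul_zero]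

end VerticalFlat

end GMLSpace

open GMLSpace in
theorem mainTheorem8 (p n : ℕ) (hp : 2 < p) (hn : 2 < n) (Q : GMLSpace p n)
    (𝒦 : ℝ) (h𝒦 : 𝒦 ≠ 0) (𝒯 : Jet p n → Idx p n → Idx p n → ℝ) (hE : Q.Einstein 𝒦 𝒯) :
    (Q.Conserved 𝒯 →
      ∀ z ∈ Q.E,
        (∀ β : Fin p,
          𝒦 * (Q.divT (Q.newT 𝒦 𝒯) z (Idx.t β)
              - 1 / (2 - (n : ℝ)) * Q.D (Idx.t β) (Q.trM (Q.newT 𝒦 𝒯)) z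
              - 1 / (2 - (p : ℝ) * n) * Q.D (Idx.t β) (Q.trV (Q.newT 𝒦 𝒯)) z)
            = - Q.divM Q.Ric z (Idx.t β) - Q.divV Q.Ric z (Idx.t β)) ∧
        (∀ j : Fin n,
          𝒦 * (- (1 / (2 - (p : ℝ)) * Q.D (Idx.x j) (Q.trT (Q.newT 𝒦 𝒯)) z)
              + Q.divM (Q.newT 𝒦 𝒯) z (Idx.x j)
              - 1 / (2 - (p : ℝ) * n) * Q.D (Idx.x j) (Q.trV (Q.newT 𝒦 𝒯)) z)
            = - Q.divV Q.Ric z (Idx.x j)) ∧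
        (∀ (i : Fin n) (α : Fin p),
          𝒦 * (- (1 / (2 - (p : ℝ)) * Q.D (Idx.v i α) (Q.trT (Q.newT 𝒦 𝒯)) z)
              - 1 / (2 - (n : ℝ)) * Q.D (Idx.v i α) (Q.trM (Q.newT 𝒦 𝒯)) z
              + Q.divV (Q.newT 𝒦 𝒯) z (Idx.v i α))
            = - Q.divM Q.Ric z (Idx.v i α))) ∧
    ((∀ z ∈ Q.E, ∀ (l q i m : Fin n) (μ : Fin p), Q.curvP z l q i m μ = 0) →
      (∀ z ∈ Q.E, ∀ (l q i m : Fin n) (α μ : Fin p), Q.curvS z l q i m α μ = 0) →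
      ∀ z ∈ Q.E,
        (∀ β : Fin p, Q.divT (Q.newT 𝒦 𝒯) z (Idx.t β) = 0) ∧
        (∀ i : Fin n, Q.divM (Q.newT 𝒦 𝒯) z (Idx.x i) = 0) ∧
        (∀ (i : Fin n) (α : Fin p), Q.divV (Q.newT 𝒦 𝒯) z (Idx.v i α) = 0)) := by

  have hp' : (2 : ℝ) - p ≠ 0 := by
    have : (2 : ℝ) < p := by exact_mod_cast hp
    linarith
  have hn' : (2 : ℝ) - n ≠ 0 := by
    have : (2 : ℝ) < n := by exact_mod_cast hn
    linarith
  have hpn' : (2 : ℝ) - p * n ≠ 0 := by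
    have h : 2 < p * n := by nlinarith
    have : (2 : ℝ) < p * n := by exact_mod_cast h
    linarith
  have sT : Q.Smooth fun w => 1 / 2 * Q.trT Q.Ric w := smooth_trT_Ric.const_mul _
  have sM : Q.Smooth fun w => 1 / 2 * Q.trM Q.Ric w := smooth_trM_Ric.const_mul _
  have sV : Q.Smooth fun w => 1 / 2 * Q.trV Q.Ric w := smooth_trV_Ric.const_mul _
  have sSc : Q.Smooth fun w => 1 / 2 * Q.Sc w :=
    (((smooth_trT_Ric.add smooth_trM_Ric).add smooth_trV_Ric).congr
      fun w _ => Sc_eq w).const_mul _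
  have hW := hE.newT_shifted h𝒦
  have nT := fun z hz => divT_shifted (z := z) h𝒦 hz sT sM sV hW
  have nM := fun z hz => divM_shifted (z := z) h𝒦 hz sT sM sV hW
  have nV := fun z hz => divV_shifted (z := z) h𝒦 hz sT sM sV hW
  have dT := fun A z hz => D_const_mul A (z := z) hz (1 / 2) (smooth_trT_Ric (Q := Q))
  have dM := fun A z hz => D_const_mul A (z := z) hz (1 / 2) (smooth_trM_Ric (Q := Q))
  have dV := fun A z hz => D_const_mul A (z := z) hz (1 / 2) (smooth_trV_Ric (Q := Q))
  refine ⟨fun hC z hz => ?_, fun hP hS z hz => ⟨fun β => ?_, fun i => ?_, fun i α => ?_⟩⟩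
  · have dSc : ∀ A, Q.D A (fun w => 1 / 2 * Q.Sc w) z = 1 / 2 * (Q.D A (Q.trT Q.Ric) z
        + Q.D A (Q.trM Q.Ric) z + Q.D A (Q.trV Q.Ric) z) := by
      intro A
      rw [← D_add A hz smooth_trT_Ric smooth_trM_Ric,
        ← D_add A hz (smooth_trT_Ric.add smooth_trM_Ric) smooth_trV_Ric,
        ← D_const_mul A hz _ ((smooth_trT_Ric.add smooth_trM_Ric).add smooth_trV_Ric)]
      exact D_congr A hz fun w _ => by rw [Sc_eq]
    -- Here f is a trace of the new tensor, g the corresponding Ricci trace and c the dimension of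
    -- the block: f = (2 - c)/(2𝒦) g, so the factor 1/(2 - c) cancels.
    have tr : ∀ A {f g : Jet p n → ℝ} {c : ℝ}, Q.Smooth g → 2 - c ≠ 0 →
        (∀ w ∈ Q.E, 𝒦 * f w = g w - 1 / 2 * g w * c) →
        𝒦 * (1 / (2 - c) * Q.D A f z) = 1 / 2 * Q.D A g z := by
      intro A f g c hg hc hf
      rw [D_congr A hz (f' := fun w => ((2 - c) / (2 * 𝒦)) * g w) fun w hw => ?_,
        D_const_mul A hz _ hg]
      · field_simp
      · have := hf w hw
        field_simp
        linarith
    have tT := fun A => tr A smooth_trT_Ric hp' fun w hw => trT_shifted hw hW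
    have tM := fun A => tr A smooth_trM_Ric hn' fun w hw => trM_shifted hw hW
    have tV := fun A => tr A smooth_trV_Ric hpn' fun w hw => trV_shifted hw hW
    have cT := divT_shifted h𝒦 hz sSc sSc sSc hE.shifted
    have cM := divM_shifted h𝒦 hz sSc sSc sSc hE.shifted
    have cV := divV_shifted h𝒦 hz sSc sSc sSc hE.shifted
    have hC' : ∀ A, 𝒦 * Q.divT 𝒯 z A + 𝒦 * Q.divM 𝒯 z A + 𝒦 * Q.divV 𝒯 z A = 0 := fun A => by
      rw [← mul_add, ← mul_add, hC z hz A, mul_zero]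
    refine ⟨fun β => ?_, fun j => ?_, fun i α => ?_⟩
    · have h := hC' (Idx.t β)
      have h' := nT z hz (Idx.t β)
      rw [cT, cM, cV, dSc] at h
      rw [dT _ z hz] at h'
      simp at h h'
      -- The conservation law carries half the derivative of H + R + S. The H part is absorbed by
      -- the divergence of the new tensor, and the R and S parts by its traces.
      linear_combination h + h' - tM (Idx.t β) - tV (Idx.t β)
    · have h := hC' (Idx.x j)
      have h' := nM z hz (Idx.x j)
      rw [cT, cM, cV, dSc, divT_Ric_x hz] at h
      rw [dM _ z hz] at h'
      simp at h h'
      linear_combination h + h' - tT (Idx.x j) - tV (Idx.x j)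
    · have h := hC' (Idx.v i α)
      have h' := nV z hz (Idx.v i α)
      rw [cT, cM, cV, dSc, divT_Ric_v hz] at h
      rw [dV _ z hz] at h'
      simp [ite_and] at h h'
      linear_combination h + h' - tT (Idx.v i α) - tM (Idx.v i α)
  · have h := nT z hz (Idx.t β)
    rw [dT _ z hz, divT_Ric hz] at h
    simpa [h𝒦] using h
  · have h := nM z hz (Idx.x i)
    rw [dM _ z hz, divM_Ric hP hz] at h
    simpa [h𝒦] using h
  · have h := nV z hz (Idx.v i α)
    -- No Bianchi identity is needed: the vertical Ricci block and its trace vanish separately.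
    rw [dV _ z hz, divV_Ric hS hz, D_congr _ hz fun w hw => trV_Ric_eq_zero hS hw, D_const] at h
    simpa [h𝒦] using h
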